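/- Let $L$ be an even lattice (a free abelian group of finite rank with a nondegenerate symmetric bilinear form $(\cdot,\cdot)$ satisfying $(l,l)\in 2\mathbb{Z}$) of signature $(p,q)$ with $p\le q$, put $\sigma(L)=p-q$, and let $I\subset L$ be a primitive isotropic sublattice of rank $p$ (assumed to exist, i.e. $L$ has Witt index $p$). Let $L^\vee$ be the dual lattice, $A_L=L^\vee/L$ the discriminant group with $q_L([x])=(x,x)/2+\mathbb{Z}$, and $\rho_L$ the Weil representation of $\mathrm{Mp}_2(\mathbb{Z})$ on $\mathbb{C}A_L=\bigoplus_\lambda\mathbb{C}\mathbf{e}_\lambda$, given on the generators $T=(\begin{pmatrix}1&1\\0&1\end{pmatrix},1)$, $S=(\begin{pmatrix}0&-1\\1&0\end{pmatrix},\sqrt{\tau})$ by $\rho_L(T)\mathbf{e}_\lambda=e(q_L(\lambda))\mathbf{e}_\lambda$ and $\rho_L(S)\mathbf{e}_\lambda=\frac{e(-\sigma(L)/8)}{\sqrt{|A_L|}}\sum_{\mu}e(-(\lambda,\mu))\mathbf{e}_\mu$, where $e(z)=\exp(2\pi i z)$. Let $M^!(L)$ be the space of weakly holomorphic modular forms of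 weight $\sigma(L)/2$ and type $\rho_L$, that is, holomorphic $f\colon\mathbb{H}\to\mathbb{C}A_L$, meromorphic at the cusp, with $f(M\tau)=\phi(\tau)^{\sigma(L)}\rho_L(M,\phi)f(\tau)$ for all $(M,\phi)\in\mathrm{Mp}_2(\mathbb{Z})$; and let $M^!$ be the space of scalar-valued weakly holomorphic modular forms of weight $0$ for $\mathrm{SL}_2(\mathbb{Z})$. Let $K=(I^\perp\cap L)/I$, a negative-definite even lattice, and $K^+=K(-1)$, with theta series $\Theta_{K^+}(\tau)=\sum_{l\in K^\vee}q^{-(l,l)/2}\mathbf{e}_{[l]}$, $q^n=e^{2\pi i n\tau}$. Let $I^*=I_{\mathbb{Q}}\cap L^\vee$ and let $L^*=L+I^*$, an even overlattice of $L$. Identify $A_{L^*}$ with $A_K$ by sending the class of $x\in (L^*)^\vee\cap I^\perp$ to the class of $x$ modulo $I_{\mathbb{Q}}$, and let ${\downarrow^L_K}\colon\mathbb{C}A_L\to\mathbb{C}A_{L^*}=\mathbb{C}A_K$ be the linear map sending $\mathbf{e}_{[x]}$ to $\mathbf{e}_{[x]}$ if $x\in (L^*)^\vee$ and to $0$ if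 $x\in L^\vee\setminus (L^*)^\vee$. For $f\in M^!(L)$ put $\xi(f)=\langle f{\downarrow^L_K},\Theta_{K^+}\rangle=\sum_{\lambda\in A_K}(f{\downarrow^L_K})_\lambda\,(\Theta_{K^+})_\lambda$, and put $\Theta^\perp=\{f\in M^!(L)\mid \xi(f)=0\}$. Then $\xi$ maps $M^!(L)$ to $M^!$, and $M^!(L)$ is closed under the $\Theta$-product $f_1*f_2=\xi(f_1)\cdot f_2$. Moreover: (1) $M^!(L)$ with the product $*$ has a left unit element (an element $u$ with $u*f=f$ for all $f\in M^!(L)$) if and only if $\xi\colon M^!(L)\to M^!$ is surjective. This always holds when $\sigma(L)=0$. (2) If there exists $f\in M^!(L)\setminus\Theta^\perp$ with $f(\tau)=o(q^{-1})$ as $\mathrm{Im}\,\tau\to\infty$, then $M^!(L)$ has a left unit element. Such an $f$ exists only when $|\sigma(L)|<24$. -/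

import Mathlib

open UpperHalfPlane Filter Asymptotics
open scoped MatrixGroups Manifold Topology

noncomputable section

namespace ThetaProduct

/-! ### The metaplectic group `Mp₂(ℤ)` -/

/-- Elements of `Mp₂(ℤ)`: pairs `(M, φ)` with `M = (a b; c d) ∈ SL₂(ℤ)` and `φ` a holomorphic
function on the upper half plane with `φ(τ)² = cτ + d`. -/
@[ext]
structure Mp2Z where
  mat : SL(2, ℤ)
  phi : ℍ → ℂ
  holo : MDifferentiable 𝓘(ℂ) 𝓘(ℂ) phi
  sq : ∀ τ : ℍ, phi τ ^ 2 = (mat 1 0 : ℂ) * τ + (mat 1 1 : ℂ)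

namespace Mp2Z

theorem mdifferentiable_smul (g : SL(2, ℤ)) :
    MDifferentiable 𝓘(ℂ) 𝓘(ℂ) (fun τ : ℍ ↦ g • τ) :=
  UpperHalfPlane.mdifferentiable_smul (g := (g : GL (Fin 2) ℝ)) (by simp)

theorem sq_eq_denom (x : Mp2Z) (τ : ℍ) : x.phi τ ^ 2 = denom (x.mat : GL (Fin 2) ℝ) τ := by
  rw [x.sq, ModularGroup.denom_apply]

theorem phi_ne_zero (x : Mp2Z) (τ : ℍ) : x.phi τ ≠ 0 := fun h ↦
  denom_ne_zero (x.mat : GL (Fin 2) ℝ) τ (by rw [← x.sq_eq_denom, h]; simp)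

theorem denom_mul (g h : SL(2, ℤ)) (τ : ℍ) :
    denom ((g * h : SL(2, ℤ)) : GL (Fin 2) ℝ) τ
      = denom (g : GL (Fin 2) ℝ) (h • τ : ℍ) * denom (h : GL (Fin 2) ℝ) τ := by
  rw [map_mul, map_mul, denom_cocycle _ _ τ.im_ne_zero, ModularGroup.sl_moeb,
    coe_smul_of_det_pos (by simp)]

instance : One Mp2Z where
  one := ⟨1, fun _ ↦ 1, mdifferentiable_const, fun τ ↦ by simp⟩

/-- `(M, φ)(N, ψ) = (MN, φ(Nτ)ψ(τ))`. -/
instance : Mul Mp2Z where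
  mul x y :=
    { mat := x.mat * y.mat
      phi := fun τ ↦ x.phi (y.mat • τ) * y.phi τ
      holo := (x.holo.comp (mdifferentiable_smul y.mat)).mul y.holo
      sq := fun τ ↦ by
        rw [mul_pow, sq_eq_denom, sq_eq_denom, ← ModularGroup.denom_apply, denom_mul] }

instance : Inv Mp2Z where
  inv x :=
    { mat := x.mat⁻¹
      phi := fun τ ↦ (x.phi (x.mat⁻¹ • τ))⁻¹
      holo := by
        have := (x.holo.comp (mdifferentiable_smul x.mat⁻¹))
        rw [UpperHalfPlane.mdifferentiable_iff] at this ⊢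
        exact this.inv fun z _ ↦ x.phi_ne_zero _
      sq := fun τ ↦ by
        have h := denom_mul x.mat x.mat⁻¹ τ
        rw [inv_pow, sq_eq_denom, ← ModularGroup.denom_apply]
        rw [mul_inv_cancel] at h
        refine inv_eq_of_mul_eq_one_right ?_
        rw [← h]
        simp [denom] }

theorem one_mat : (1 : Mp2Z).mat = 1 := rfl
theorem one_phi : (1 : Mp2Z).phi = fun _ ↦ 1 := rfl
theorem mul_mat (x y : Mp2Z) : (x * y).mat = x.mat * y.mat := rfl
theorem mul_phi (x y : Mp2Z) : (x * y).phi = fun τ ↦ x.phi (y.mat • τ) * y.phi τ := rfl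
theorem inv_mat (x : Mp2Z) : (x⁻¹).mat = x.mat⁻¹ := rfl
theorem inv_phi (x : Mp2Z) : (x⁻¹).phi = fun τ ↦ (x.phi (x.mat⁻¹ • τ))⁻¹ := rfl

instance : Group Mp2Z where
  mul_assoc x y z := by
    apply Mp2Z.ext
    · simp only [mul_mat, mul_assoc]
    · funext τ; simp only [mul_mat, mul_phi, mul_smul, mul_assoc]
  one_mul x := by
    apply Mp2Z.ext
    · simp only [mul_mat, one_mat, one_mul]
    · funext τ; simp only [mul_phi, one_phi, one_mul]
  mul_one x := by
    apply Mp2Z.ext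
    · simp only [mul_mat, one_mat, mul_one]
    · funext τ; simp only [mul_phi, one_phi, one_mat, one_smul, mul_one]
  inv_mul_cancel x := by
    apply Mp2Z.ext
    · simp only [mul_mat, inv_mat, one_mat, inv_mul_cancel]
    · funext τ
      simp only [mul_phi, inv_phi, one_phi, inv_smul_smul]
      exact inv_mul_cancel₀ (x.phi_ne_zero τ)

/-- The generator `T = ((1 1; 0 1), 1)`. -/
def T : Mp2Z where
  mat := ModularGroup.T
  phi := fun _ ↦ 1
  holo := mdifferentiable_const
  sq := fun τ ↦ by simp [ModularGroup.T]

/-- The generator `S = ((0 -1; 1 0), √τ)`, with the principal branch of the square root. -/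
def S : Mp2Z where
  mat := ModularGroup.S
  phi := fun τ ↦ (τ : ℂ) ^ (2⁻¹ : ℂ)
  holo := by
    rw [UpperHalfPlane.mdifferentiable_iff]
    have h : DifferentiableOn ℂ (fun z : ℂ ↦ z ^ (2⁻¹ : ℂ)) {z | 0 < z.im} := fun z hz ↦
      (differentiableAt_id.cpow_const
        (Or.inr (ne_of_gt hz))).differentiableWithinAt
    refine h.congr fun z hz ↦ ?_
    simp only [Function.comp_apply, ofComplex_apply_of_im_pos hz]
  sq := fun τ ↦ by
    have := Complex.cpow_nat_inv_pow (τ : ℂ) (n := 2) two_ne_zero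
    simp only [Nat.cast_ofNat] at this
    rw [this]
    simp [ModularGroup.S]

end Mp2Z

/-- `e(x) = exp(2πix)` on `ℚ/ℤ`. -/
def e : AddCircle (1 : ℚ) → ℂ :=
  Function.Periodic.lift (f := fun x : ℚ ↦ Complex.exp (2 * Real.pi * Complex.I * (x : ℂ)))
    (c := 1) (fun x ↦ by
      simp only [Rat.cast_add, Rat.cast_one, mul_add, mul_one]
      exact Complex.exp_periodic _)

/-- `q^r = exp(2πirτ)` for a rational exponent `r`. -/
def qpow (r : ℚ) (τ : ℍ) : ℂ := Complex.exp (2 * Real.pi * Complex.I * (r : ℂ) * (τ : ℂ))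

/-! ### Even lattices and discriminant forms -/

/-- An even lattice, realized as a full `ℤ`-lattice in its rational quadratic space `V = L ⊗ ℚ`,
with `(x, x) ∈ 2ℤ` for all `x ∈ L`. (By polarization the form is then integral on `L`.) -/
structure EvenLattice (V : Type*) [AddCommGroup V] [Module ℚ V] where
  form : LinearMap.BilinForm ℚ V
  symm : form.IsSymm
  nondeg : form.Nondegenerate
  carrier : Submodule ℤ V
  fg : carrier.FG
  span_eq_top : Submodule.span ℚ (carrier : Set V) = ⊤
  even : ∀ x ∈ carrier, ∃ n : ℤ, form x x = 2 * n

namespace EvenLattice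

variable {V : Type*} [AddCommGroup V] [Module ℚ V] (L : EvenLattice V)

/-- Signature `(p, q)`: the number `p`. -/
def sigP : ℕ := sigPos L.form.toQuadraticMap

/-- Signature `(p, q)`: the number `q`. -/
def sigQ : ℕ := sigNeg L.form.toQuadraticMap

/-- `σ(L) = p - q`. -/
def sigma : ℤ := (L.sigP : ℤ) - (L.sigQ : ℤ)

/-- The dual lattice `L^∨ = {x ∈ V | (x, L) ⊂ ℤ}`. -/
def dual : Submodule ℤ V := L.form.dualSubmodule L.carrier

/-- The discriminant group `A_L = L^∨ / L`. -/
abbrev A : Type _ := L.dual ⧸ L.carrier.submoduleOf L.dual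

/-- The class in `A_L` of a vector of `L^∨`. -/
def cls (x : L.dual) : L.A := Submodule.Quotient.mk x

theorem finiteDimensional (L : EvenLattice V) : FiniteDimensional ℚ V := by
  obtain ⟨s, hs⟩ := L.fg
  refine ⟨s, ?_⟩
  rw [← L.span_eq_top, ← hs]
  exact (Submodule.span_span_of_tower ℤ ℚ (s : Set V)).symm

theorem exists_smul_mem (x : V) : ∃ n : ℤ, n ≠ 0 ∧ n • x ∈ L.carrier := by
  have hx : x ∈ Submodule.span ℚ (L.carrier : Set V) := by rw [L.span_eq_top]; trivial
  induction hx using Submodule.span_induction with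
  | mem x h => exact ⟨1, one_ne_zero, by simpa using h⟩
  | zero => exact ⟨1, one_ne_zero, by simp⟩
  | add x y _ _ hx hy =>
    obtain ⟨n, hn, hx⟩ := hx
    obtain ⟨m, hm, hy⟩ := hy
    refine ⟨n * m, mul_ne_zero hn hm, ?_⟩
    rw [smul_add]
    refine add_mem ?_ ?_
    · rw [mul_comm, mul_smul]; exact L.carrier.smul_mem m hx
    · rw [mul_smul]; exact L.carrier.smul_mem n hy
  | smul a x _ hx =>
    obtain ⟨n, hn, hx⟩ := hx
    refine ⟨n * a.den, mul_ne_zero hn (by exact_mod_cast a.den_ne_zero), ?_⟩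
    have : (n * (a.den : ℤ)) • a • x = a.num • n • x := by
      rw [← Int.cast_smul_eq_zsmul ℚ (n * (a.den : ℤ)), ← Int.cast_smul_eq_zsmul ℚ a.num,
        ← Int.cast_smul_eq_zsmul ℚ n, smul_smul, smul_smul]
      congr 1
      push_cast
      rw [mul_assoc, Rat.den_mul_eq_num, mul_comm]
    rw [this]
    exact L.carrier.smul_mem _ hx

theorem dual_fg : L.dual.FG := by
  classical
  have := L.finiteDimensional
  let b := Module.Basis.ofSpan L.span_eq_top.ge
  have hb : Set.range b ⊆ (L.carrier : Set V) := Module.Basis.ofSpan_subset L.span_eq_top.ge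
  have : Finite _ := Module.Finite.finite_basis b
  have h1 : L.dual ≤ L.form.dualSubmodule (Submodule.span ℤ (Set.range b)) :=
    fun x hx y hy ↦ hx y (Submodule.span_le.mpr hb hy)
  rw [LinearMap.BilinForm.dualSubmodule_span_of_basis L.form L.nondeg b] at h1
  exact (Submodule.fg_span (Set.finite_range _)).of_le h1

instance : Finite L.A := by
  have : Module.Finite ℤ L.dual := Module.Finite.iff_fg.mpr L.dual_fg
  refine Module.finite_of_fg_torsion L.A ?_
  intro x
  induction x using Submodule.Quotient.induction_on with
  | H x =>
    obtain ⟨n, hn, h⟩ := L.exists_smul_mem (x : V)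
    refine ⟨⟨n, mem_nonZeroDivisors_of_ne_zero hn⟩, ?_⟩
    exact (Submodule.Quotient.mk_eq_zero _).mpr h

instance : Fintype L.A := Fintype.ofFinite _

theorem dual_pair {x y : V} (hx : x ∈ L.dual) (hy : y ∈ L.carrier) :
    ∃ n : ℤ, L.form x y = n := by
  obtain ⟨n, hn⟩ := Submodule.mem_one.mp (hx y hy)
  exact ⟨n, by simpa using hn.symm⟩

/-- The discriminant form `q_L([x]) = (x, x)/2 + ℤ`. -/
def q (a : L.A) : AddCircle (1 : ℚ) :=
  Quotient.liftOn' a (fun x ↦ ((L.form x x / 2 : ℚ) : AddCircle (1 : ℚ))) (by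
    intro x y hxy
    have hm : (x : V) - y ∈ L.carrier :=
      (Submodule.quotientRel_def (L.carrier.submoduleOf L.dual)).mp hxy
    obtain ⟨a, ha⟩ := L.even _ hm
    obtain ⟨b, hb⟩ := L.dual_pair y.2 hm
    have h := L.symm.eq (x : V) y
    simp only [map_sub, LinearMap.sub_apply] at ha hb h
    refine (QuotientAddGroup.eq_iff_sub_mem).mpr
      (AddSubgroup.mem_zmultiples_iff.mpr ⟨a + b, ?_⟩)
    simp only [zsmul_eq_mul, mul_one]
    push_cast
    linarith)

/-- The bilinear form `([x], [y]) = (x, y) + ℤ` on `A_L`. -/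
def pair (a b : L.A) : AddCircle (1 : ℚ) :=
  Quotient.liftOn₂' a b (fun x y ↦ ((L.form x y : ℚ) : AddCircle (1 : ℚ))) (by
    intro x y x' y' hx hy
    have hm : (x : V) - x' ∈ L.carrier :=
      (Submodule.quotientRel_def (L.carrier.submoduleOf L.dual)).mp hx
    have hm' : (y : V) - y' ∈ L.carrier :=
      (Submodule.quotientRel_def (L.carrier.submoduleOf L.dual)).mp hy
    obtain ⟨a, ha⟩ := L.dual_pair y.2 hm
    obtain ⟨b, hb⟩ := L.dual_pair x'.2 hm'
    have h := L.symm.eq (x : V) y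
    have h' := L.symm.eq (x' : V) y
    simp only [map_sub] at ha hb h h'
    refine (QuotientAddGroup.eq_iff_sub_mem).mpr
      (AddSubgroup.mem_zmultiples_iff.mpr ⟨a + b, ?_⟩)
    simp only [zsmul_eq_mul, mul_one]
    push_cast
    linarith)

/-! ### The Weil representation and weakly holomorphic modular forms

`ℂA_L` is the space of functions `L.A → ℂ`; the basis vector `e_λ` is `Pi.single λ 1`. -/

/-- `ρ_L(T) e_λ = e(q(λ)) e_λ`. -/
def weilT : Module.End ℂ (L.A → ℂ) where
  toFun v := fun l ↦ e (L.q l) * v l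
  map_add' v w := by funext l; simp [mul_add]
  map_smul' c v := by funext l; simp [mul_left_comm]

/-- `ρ_L(S) e_λ = e(-σ(L)/8) / √|A_L| · ∑_μ e(-(λ, μ)) e_μ`. -/
def weilS : Module.End ℂ (L.A → ℂ) where
  toFun v := fun m ↦
    e ((-(L.sigma : ℚ) / 8 : ℚ) : AddCircle (1 : ℚ)) / (Real.sqrt (Fintype.card L.A) : ℂ)
      * ∑ l, e (-(L.pair l m)) * v l
  map_add' v w := by funext m; simp [mul_add, Finset.sum_add_distrib]
  map_smul' c v := by
    funext m
    simp only [Pi.smul_apply, smul_eq_mul, RingHom.id_apply]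
    rw [mul_left_comm, Finset.mul_sum (a := c)]
    congr 1
    exact Finset.sum_congr rfl fun l _ ↦ by ring

/-- The graph of the Weil representation `ρ_L : Mp₂(ℤ) → GL(ℂA_L)`. Since `ρ_L` is the
representation determined by its values on `T` and `S`, which generate `Mp₂(ℤ)` (also as a monoid,
because `S⁸ = 1` and `(ST)³ = S²`), its graph is generated by `(T, ρ_L(T))` and `(S, ρ_L(S))`. -/
def weilGraph : Submonoid (Mp2Z × Module.End ℂ (L.A → ℂ)) :=
  Submonoid.closure {(Mp2Z.T, L.weilT), (Mp2Z.S, L.weilS)}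

end EvenLattice

/-- Meromorphy at the cusp `i∞`, for a holomorphic function on `ℍ` which is periodic under some
`τ ↦ τ + N`: it is `O(q^{-n})` for some `n`. -/
def MeromorphicAtCusp (f : ℍ → ℂ) : Prop :=
  ∃ n : ℕ, f =O[atImInfty] qpow (-(n : ℚ))

theorem qpow_isBigO {m n : ℕ} (h : m ≤ n) :
    qpow (-(m : ℚ)) =O[atImInfty] qpow (-(n : ℚ)) := by
  refine IsBigO.of_bound 1 (Eventually.of_forall fun τ ↦ ?_)
  simp only [qpow, Complex.norm_exp, one_mul]
  refine Real.exp_le_exp.mpr ?_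
  have h1 : (m : ℝ) ≤ n := by exact_mod_cast h
  have h2 := τ.im_pos
  have h3 := Real.pi_pos
  have key : ∀ k : ℕ, (2 * (Real.pi : ℂ) * Complex.I * ((-(k : ℚ) : ℚ) : ℂ) * (τ : ℂ)).re
      = 2 * Real.pi * τ.im * k := by
    intro k
    have : (2 * (Real.pi : ℂ) * Complex.I * ((-(k : ℚ) : ℚ) : ℂ) * (τ : ℂ))
        = ((2 * Real.pi * -(k : ℝ) : ℝ) : ℂ) * (Complex.I * (τ : ℂ)) := by
      push_cast; ring
    rw [this, Complex.re_ofReal_mul]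
    simp
    ring
  rw [key, key]
  gcongr

theorem MeromorphicAtCusp.add {f g : ℍ → ℂ} (hf : MeromorphicAtCusp f)
    (hg : MeromorphicAtCusp g) : MeromorphicAtCusp (fun τ ↦ f τ + g τ) := by
  obtain ⟨m, hm⟩ := hf
  obtain ⟨n, hn⟩ := hg
  exact ⟨max m n, (hm.trans (qpow_isBigO (le_max_left m n))).add
    (hn.trans (qpow_isBigO (le_max_right m n)))⟩

theorem MeromorphicAtCusp.const_mul {f : ℍ → ℂ} (c : ℂ) (hf : MeromorphicAtCusp f) :
    MeromorphicAtCusp (fun τ ↦ c * f τ) := by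
  obtain ⟨m, hm⟩ := hf
  exact ⟨m, hm.const_mul_left c⟩

theorem meromorphicAtCusp_zero : MeromorphicAtCusp (fun _ ↦ 0) :=
  ⟨0, isBigO_zero _ _⟩

/-- `M^!`: the scalar-valued weakly holomorphic modular forms of weight `0` for `SL₂(ℤ)`. -/
def MShriek : Submodule ℂ (ℍ → ℂ) where
  carrier := {f | MDifferentiable 𝓘(ℂ) 𝓘(ℂ) f ∧ (∀ (g : SL(2, ℤ)) (τ : ℍ), f (g • τ) = f τ) ∧
    MeromorphicAtCusp f}
  zero_mem' := ⟨mdifferentiable_const, fun _ _ ↦ rfl, meromorphicAtCusp_zero⟩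
  add_mem' := fun hf hg ↦ ⟨hf.1.add hg.1, fun g τ ↦ by
    simp only [Pi.add_apply, hf.2.1, hg.2.1], hf.2.2.add hg.2.2⟩
  smul_mem' := fun c f hf ↦ ⟨hf.1.const_smul c, fun g τ ↦ by
    simp only [Pi.smul_apply, hf.2.1], hf.2.2.const_mul c⟩

namespace EvenLattice

variable {V : Type*} [AddCommGroup V] [Module ℚ V] (L : EvenLattice V)

/-- `M^!(L)`: the weakly holomorphic modular forms of weight `k = σ(L)/2` and type `ρ_L`, i.e.
holomorphic `f : ℍ → ℂA_L` with `f(Mτ) = φ(τ)^{2k} ρ_L(M, φ) f(τ)` for all `(M, φ) ∈ Mp₂(ℤ)`,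
meromorphic at the cusp. -/
def MShriek : Submodule ℂ (ℍ → L.A → ℂ) where
  carrier := {f | (∀ l, MDifferentiable 𝓘(ℂ) 𝓘(ℂ) (fun τ ↦ f τ l)) ∧
    (∀ x ∈ L.weilGraph, ∀ τ : ℍ, f (x.1.mat • τ) = x.1.phi τ ^ L.sigma • x.2 (f τ)) ∧
    ∀ l, MeromorphicAtCusp (fun τ ↦ f τ l)}
  zero_mem' := ⟨fun _ ↦ mdifferentiable_const, fun x _ τ ↦ by simp,
    fun _ ↦ meromorphicAtCusp_zero⟩
  add_mem' := fun hf hg ↦ ⟨fun l ↦ (hf.1 l).add (hg.1 l), fun x hx τ ↦ by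
    simp only [Pi.add_apply, hf.2.1 x hx, hg.2.1 x hx, map_add, smul_add],
    fun l ↦ (hf.2.2 l).add (hg.2.2 l)⟩
  smul_mem' := fun c f hf ↦ ⟨fun l ↦ (hf.1 l).const_smul c, fun x hx τ ↦ by
    simp only [Pi.smul_apply, hf.2.1 x hx, map_smul, smul_comm c],
    fun l ↦ (hf.2.2 l).const_mul c⟩

/-- The theta series `Θ_{L(-1)}(τ) = ∑_{x ∈ L^∨} q^{-(x, x)/2} e_{[x]}` of `L(-1)`, for `L` negative
definite. Its components are indexed by `A_{L(-1)}`, which is the same group as `A_L`. -/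
def thetaNeg (τ : ℍ) (l : L.A) : ℂ :=
  ∑' x : {x : L.dual // L.cls x = l}, qpow (-(L.form x.1 x.1) / 2) τ

open Classical in
/-- The pushforward `↓ : ℂA_L → ℂA_{L'}` to an even overlattice `L ⊂ L' ⊂ L'^∨ ⊂ L^∨`: `e_μ` goes to
`e_{p(μ)}` if `μ ∈ (L'/L)^⊥ = L'^∨/L`, where `p : L'^∨/L → L'^∨/L'`, and to `0` otherwise. -/
def push (L' : EvenLattice V) (v : L.A → ℂ) : L'.A → ℂ := fun l ↦
  ∑ m, if ∃ (x : V) (h : x ∈ L.dual) (h' : x ∈ L'.dual), L.cls ⟨x, h⟩ = m ∧ L'.cls ⟨x, h'⟩ = l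
    then v m else 0

/-- A maximal isotropic sublattice: a primitive isotropic sublattice of rank `p`, where `L` has
signature `(p, q)`. -/
structure MaximalIsotropic where
  carrier : Submodule ℤ V
  le : carrier ≤ L.carrier
  isotropic : ∀ x ∈ carrier, ∀ y ∈ carrier, L.form x y = 0
  primitive : ∀ (n : ℤ) (x : V), n ≠ 0 → x ∈ L.carrier → n • x ∈ carrier → x ∈ carrier
  finrank_eq : Module.finrank ℤ carrier = L.sigP

namespace MaximalIsotropic

variable {L} (I : L.MaximalIsotropic)

/-- `I_ℚ`. -/
def rat : Submodule ℚ V := Submodule.span ℚ (I.carrier : Set V)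

theorem rat_isotropic {x y : V} (hx : x ∈ I.rat) (hy : y ∈ I.rat) : L.form x y = 0 := by
  induction hx using Submodule.span_induction with
  | zero => simp
  | add x x' _ _ h h' => simp [h, h']
  | smul a x _ h => simp [h]
  | mem x hx =>
    induction hy using Submodule.span_induction with
    | zero => simp
    | add x x' _ _ h h' => simp [h, h']
    | smul a x _ h => simp [h]
    | mem y hy => exact I.isotropic x hx y hy

/-- `I^* = I_ℚ ∩ L^∨`. -/
def star : Submodule ℤ V := I.rat.restrictScalars ℤ ⊓ L.dual

/-- The overlattice `L^* = ⟨L, I^*⟩` of `L`. -/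
def overlattice : EvenLattice V where
  form := L.form
  symm := L.symm
  nondeg := L.nondeg
  carrier := L.carrier ⊔ I.star
  fg := L.fg.sup (L.dual_fg.of_le inf_le_right)
  span_eq_top := by
    rw [eq_top_iff, ← L.span_eq_top]
    exact Submodule.span_mono (SetLike.coe_subset_coe.mpr le_sup_left)
  even := by
    intro z hz
    obtain ⟨x, hx, y, hy, rfl⟩ := Submodule.mem_sup.mp hz
    obtain ⟨a, ha⟩ := L.even x hx
    obtain ⟨b, hb⟩ := L.dual_pair hy.2 hx
    have h0 : L.form y y = 0 := I.rat_isotropic hy.1 hy.1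
    have h := L.symm.eq x y
    refine ⟨a + b, ?_⟩
    simp only [map_add, LinearMap.add_apply] at h ⊢
    push_cast
    linarith

/-- `I^⊥` in `V`. -/
def perp : Submodule ℚ V := L.form.orthogonal I.rat

/-- `K ⊗ ℚ = I^⊥ / I_ℚ`. -/
abbrev W : Type _ := I.perp ⧸ I.rat.submoduleOf I.perp

theorem form_perp_left {x y : V} (hx : x ∈ I.rat) (hy : y ∈ I.perp) : L.form x y = 0 := hy x hx

theorem form_perp_right {x y : V} (hx : x ∈ I.perp) (hy : y ∈ I.rat) : L.form x y = 0 := by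
  have := L.symm.eq y x
  rw [hx y hy] at this
  exact this.symm

/-- The bilinear form on `I^⊥ / I_ℚ` induced from that of `V`. -/
def formW : LinearMap.BilinForm ℚ I.W :=
  LinearMap.mk₂ ℚ
    (fun a b ↦ Quotient.liftOn₂' a b (fun x y ↦ L.form x y) (by
      intro x y x' y' hx hy
      have hm : (x : V) - x' ∈ I.rat :=
      (Submodule.quotientRel_def (I.rat.submoduleOf I.perp)).mp hx
      have hm' : (y : V) - y' ∈ I.rat :=
      (Submodule.quotientRel_def (I.rat.submoduleOf I.perp)).mp hy
      have h1 := I.form_perp_left hm y.2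
      have h2 := I.form_perp_right x'.2 hm'
      simp only [map_sub, LinearMap.sub_apply] at h1 h2 ⊢
      linarith))
    (by rintro ⟨a⟩ ⟨b⟩ ⟨c⟩; exact LinearMap.map_add₂ L.form a.1 b.1 c.1)
    (by rintro c ⟨a⟩ ⟨b⟩; exact LinearMap.map_smul₂ L.form c a.1 b.1)
    (by rintro ⟨a⟩ ⟨b⟩ ⟨c⟩; exact map_add (L.form a.1) b.1 c.1)
    (by rintro c ⟨a⟩ ⟨b⟩; exact map_smul (L.form a.1) c b.1)

/-- The projection `I^⊥ → I^⊥ / I_ℚ`. -/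
def proj : I.perp →ₗ[ℚ] I.W := Submodule.mkQ _

theorem formW_proj (x y : I.perp) : I.formW (I.proj x) (I.proj y) = L.form x y := rfl

theorem proj_surjective : Function.Surjective I.proj := Submodule.mkQ_surjective _

/-- The lattice `K = (I^⊥ ∩ L) / I`, in `K ⊗ ℚ = I^⊥ / I_ℚ`. -/
def K : EvenLattice I.W where
  form := I.formW
  symm := ⟨fun a b ↦ by
    obtain ⟨x, rfl⟩ := I.proj_surjective a
    obtain ⟨y, rfl⟩ := I.proj_surjective b
    exact L.symm.eq x.1 y.1⟩
  nondeg := by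
    have := L.finiteDimensional
    have key : ∀ x : I.perp, (∀ y : I.perp, L.form y x = 0) → I.proj x = 0 := by
      intro x hx
      have : (x : V) ∈ L.form.orthogonal (L.form.orthogonal I.rat) :=
        fun y hy ↦ hx ⟨y, hy⟩
      rw [LinearMap.BilinForm.orthogonal_orthogonal L.nondeg L.symm.isRefl] at this
      exact (Submodule.Quotient.mk_eq_zero _).mpr this
    constructor
    · intro a ha
      obtain ⟨x, rfl⟩ := I.proj_surjective a
      refine key x fun y ↦ ?_
      have h := L.symm.eq x.1 y.1
      rw [← I.formW_proj, ha] at h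
      exact h.symm
    · intro a ha
      obtain ⟨x, rfl⟩ := I.proj_surjective a
      exact key x fun y ↦ ha (I.proj y)
  carrier := (L.carrier.comap (I.perp.subtype.restrictScalars ℤ)).map (I.proj.restrictScalars ℤ)
  fg := by
    refine Submodule.FG.map _ ?_
    refine Submodule.fg_of_fg_map_injective (I.perp.subtype.restrictScalars ℤ)
      Subtype.val_injective ?_
    exact L.fg.of_le (Submodule.map_comap_le _ _)
  span_eq_top := by
    rw [eq_top_iff]
    rintro a -
    obtain ⟨x, rfl⟩ := I.proj_surjective a
    obtain ⟨n, hn, h⟩ := L.exists_smul_mem (x : V)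
    have h2 : I.proj (n • x) ∈ Submodule.span ℚ
        (((L.carrier.comap (I.perp.subtype.restrictScalars ℤ)).map
          (I.proj.restrictScalars ℤ) : Submodule ℤ I.W) : Set I.W) :=
      Submodule.subset_span ⟨n • x, h, rfl⟩
    have hn' : (n : ℚ) ≠ 0 := by exact_mod_cast hn
    rw [map_zsmul, ← Int.cast_smul_eq_zsmul ℚ] at h2
    exact (Submodule.smul_mem_iff _ hn').mp h2
  even := by
    rintro a ⟨x, hx, rfl⟩
    exact L.even x.1 hx

open Classical in
/-- The identification `ℂA_{L^*} = ℂA_K` induced by the canonical isometry `A_{L^*} ≃ A_K`. The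
isometry comes from any splitting `L^* = φ(pU) ⊕ φ(pU)^⊥` with `φ(I_p) = I^*` and
`φ(pU)^⊥ ≃ K` the projection modulo `I^*`; so it sends the class of `x ∈ L^{*∨} ∩ I^⊥` to the class
of `x mod I_ℚ` in `A_K`, and every class of `A_{L^*}` contains such an `x`. -/
def ident (v : I.overlattice.A → ℂ) : I.K.A → ℂ := fun l ↦
  ∑ m, if ∃ (x : I.perp) (h : (x : V) ∈ I.overlattice.dual) (h' : I.proj x ∈ I.K.dual),
      I.overlattice.cls ⟨x, h⟩ = m ∧ I.K.cls ⟨I.proj x, h'⟩ = l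
    then v m else 0

/-- `↓^L_K : ℂA_L → ℂA_{L^*} = ℂA_K`. -/
def down (v : L.A → ℂ) : I.K.A → ℂ := I.ident (L.push I.overlattice v)

/-- `ξ(f) = ⟨f↓^L_K, Θ_{K^+}⟩` with `K^+ = K(-1)`. -/
def xi (f : ℍ → L.A → ℂ) : ℍ → ℂ := fun τ ↦ ∑ l, I.down (f τ) l * I.K.thetaNeg τ l

/-- The `Θ`-product `f₁ * f₂ = ξ(f₁) · f₂` with respect to `I`. -/
def thetaProd (f₁ f₂ : ℍ → L.A → ℂ) : ℍ → L.A → ℂ := fun τ ↦ I.xi f₁ τ • f₂ τ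

/-- `Θ^⊥ = {f ∈ M^!(L) | ξ(f) = 0}`. -/
def thetaPerp : Set (ℍ → L.A → ℂ) := {f | f ∈ L.MShriek ∧ I.xi f = 0}

/-- `M^!(L)`, with the `Θ`-product, has a left unit element. -/
def HasLeftUnit : Prop := ∃ u ∈ L.MShriek, ∀ f ∈ L.MShriek, I.thetaProd u f = f

end MaximalIsotropic

/-- `f = o(q^{-1})` as `τ → i∞`. -/
def IsLittleOQInv (f : ℍ → L.A → ℂ) : Prop :=
  ∀ l, (fun τ ↦ f τ l) =o[atImInfty] qpow (-1)

end EvenLattice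

end ThetaProduct

end

/-!
By Poisson summation the theta series of `K` transforms under the dual of the Weil representation
of `K`. The map `↓^L_K` is the transfer along a Lagrangian correspondence between `A_L` and `A_K`,
hence commutes with Weil representations, and `ξ(f) = ∑ₐ fₐ θₐ` for the transposed theta series
`θ` with values in `ℂA_L`. So `ξ(f)` is invariant under `S` and `T`.

If `u` is a left unit, then `(ξ(u) - 1) f = 0` for all `f`. Comparing with `ξ(u) = 1` needs a
nonzero form in `M^!(L)`; it is obtained by Zarhin's quaternion trick. Write
`2|A_L| = 1 + a² + b² + c² + d²`. The quaternion `a + bi + cj + dk` has norm `-1` modulo `2|A_L|`,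
so the graph of left multiplication by it on `A_L⁴`, regarded as a correspondence between `A_L` and
`A_L⁷`, is Lagrangian. Seven copies of `θ`, which is of type dual to `ρ_L`, transfer along it to a
form of type `ρ_L` with positive zeroth component at `i`, and a power of `E₄² / Δ` corrects the
weight. For `σ(L) = 0` no correction is needed, and the image of this form under `ξ` is nonzero.

If `f = o(q⁻¹)`, then `ξ(f) Δ` is a cusp form of weight `12`, so `ξ(f)` is constant. If in addition
`σ(L) ≤ -24`, then `‖η^{-σ(L)} f‖` is `SL₂(ℤ)`-invariant and tends to `0` at the cusp, so `f = 0`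
by the maximum principle.
-/

noncomputable section

namespace ThetaProduct

local notation "ℚ/ℤ" => AddCircle (1 : ℚ)

theorem e_coe (x : ℚ) : e (x : ℚ/ℤ) = Complex.exp (2 * Real.pi * Complex.I * x) := rfl

theorem e_zero : e 0 = 1 := by
  rw [← AddCircle.coe_zero, e_coe, Rat.cast_zero, mul_zero, Complex.exp_zero]

theorem e_add (x y : ℚ/ℤ) : e (x + y) = e x * e y := by
  induction x using QuotientAddGroup.induction_on with | H x =>
  induction y using QuotientAddGroup.induction_on with | H y =>
  change e ((x + y : ℚ) : ℚ/ℤ) = e (x : ℚ/ℤ) * e (y : ℚ/ℤ)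
  rw [e_coe, e_coe, e_coe, ← Complex.exp_add, Rat.cast_add, mul_add]

/-- The function `e` as an additive character of `ℚ/ℤ`. -/
def eChar : AddChar ℚ/ℤ ℂ := ⟨e, e_zero, e_add⟩

theorem e_neg (x : ℚ/ℤ) : e (-x) = (e x)⁻¹ := AddChar.map_neg_eq_inv eChar x

theorem e_nsmul (n : ℕ) (x : ℚ/ℤ) : e (n • x) = e x ^ n := AddChar.map_nsmul_eq_pow eChar n x

theorem e_sum {ι : Type*} (s : Finset ι) (x : ι → ℚ/ℤ) :
    e (∑ i ∈ s, x i) = ∏ i ∈ s, e (x i) :=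
  map_prod eChar.toMonoidHom (fun i ↦ Multiplicative.ofAdd (x i)) s

theorem norm_e (x : ℚ/ℤ) : ‖e x‖ = 1 := by
  induction x using QuotientAddGroup.induction_on with | H x =>
  rw [e_coe, show 2 * Real.pi * Complex.I * (x : ℂ) = (2 * Real.pi * x : ℝ) * Complex.I by
    push_cast; ring, Complex.norm_exp_ofReal_mul_I]

theorem conj_e (x : ℚ/ℤ) : (starRingEnd ℂ) (e x) = e (-x) := by
  rw [e_neg, Complex.inv_eq_conj (norm_e x)]

theorem e_eq_one_iff (x : ℚ/ℤ) : e x = 1 ↔ x = 0 := by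
  induction x using QuotientAddGroup.induction_on with | H x =>
  rw [e_coe, Complex.exp_eq_one_iff, AddCircle.coe_eq_zero_iff]
  refine exists_congr fun n ↦ ?_
  rw [mul_comm (n : ℂ), mul_right_inj' Complex.two_pi_I_ne_zero, zsmul_one, eq_comm]
  exact_mod_cast Iff.rfl

/-! ### Finite Fourier transforms and Lagrangian correspondences -/

section Pairings

variable {A B : Type*} [AddCommGroup A] [AddCommGroup B]

/-- A nondegenerate symmetric pairing of an abelian group with itself, with values in `ℚ/ℤ`. -/
structure IsNondegSymm (P : A →+ A →+ ℚ/ℤ) : Prop where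
  symm : ∀ a b, P a b = P b a
  injective : Function.Injective P

/-- The orthogonal sum of two pairings. -/
def prodPairing (P : A →+ A →+ ℚ/ℤ) (Q : B →+ B →+ ℚ/ℤ) : A × B →+ A × B →+ ℚ/ℤ :=
  (P.compl₂ (.fst A B)).comp (.fst A B) + (Q.compl₂ (.snd A B)).comp (.snd A B)

/-- The orthogonal sum of a finite family of pairings. -/
def piPairing {ι : Type*} [Fintype ι] {A : ι → Type*} [∀ i, AddCommGroup (A i)]
    (P : ∀ i, A i →+ A i →+ ℚ/ℤ) : (∀ i, A i) →+ (∀ i, A i) →+ ℚ/ℤ :=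
  ∑ i, ((P i).compl₂ (Pi.evalAddMonoidHom A i)).comp (Pi.evalAddMonoidHom A i)

theorem prodPairing_apply (P : A →+ A →+ ℚ/ℤ) (Q : B →+ B →+ ℚ/ℤ) (x y : A × B) :
    prodPairing P Q x y = P x.1 y.1 + Q x.2 y.2 := rfl

theorem piPairing_apply {ι : Type*} [Fintype ι] {A : ι → Type*} [∀ i, AddCommGroup (A i)]
    (P : ∀ i, A i →+ A i →+ ℚ/ℤ) (x y : ∀ i, A i) :
    piPairing P x y = ∑ i, P i (x i) (y i) := by
  simp [piPairing, AddMonoidHom.finsetSum_apply]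

theorem neg_piPairing {ι : Type*} [Fintype ι] {A : ι → Type*} [∀ i, AddCommGroup (A i)]
    (P : ∀ i, A i →+ A i →+ ℚ/ℤ) : -piPairing P = piPairing fun i ↦ -P i := by
  ext x y
  simp [piPairing_apply]

namespace IsNondegSymm

variable {P : A →+ A →+ ℚ/ℤ} {Q : B →+ B →+ ℚ/ℤ}

theorem eq_zero (hP : IsNondegSymm P) {a : A} (h : ∀ b, P a b = 0) : a = 0 :=
  hP.injective <| by ext b; simp [h]

theorem neg (hP : IsNondegSymm P) : IsNondegSymm (-P) where
  symm a b := congrArg Neg.neg (hP.symm a b)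
  injective := neg_injective.comp hP.injective

theorem prod (hP : IsNondegSymm P) (hQ : IsNondegSymm Q) : IsNondegSymm (prodPairing P Q) where
  symm x y := by rw [prodPairing_apply, prodPairing_apply, hP.symm, hQ.symm]
  injective := (injective_iff_map_eq_zero _).mpr fun x hx ↦ Prod.ext
    (hP.eq_zero fun a ↦ by simpa [prodPairing_apply] using DFunLike.congr_fun hx (a, 0))
    (hQ.eq_zero fun b ↦ by simpa [prodPairing_apply] using DFunLike.congr_fun hx (0, b))

theorem pi {ι : Type*} [Fintype ι] {A : ι → Type*} [∀ i, AddCommGroup (A i)]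
    {P : ∀ i, A i →+ A i →+ ℚ/ℤ} (hP : ∀ i, IsNondegSymm (P i)) :
    IsNondegSymm (piPairing P) where
  symm x y := by simp only [piPairing_apply, (hP _).symm]
  injective := by
    classical
    refine (injective_iff_map_eq_zero _).mpr fun x hx ↦ funext fun i ↦ (hP i).eq_zero fun b ↦ ?_
    have h := DFunLike.congr_fun hx (Pi.single i b)
    rwa [piPairing_apply, Finset.sum_eq_single i (fun j _ hj ↦ by simp [hj]) (by simp),
      Pi.single_eq_same] at h

end IsNondegSymm

open Classical in
theorem sum_e_hom [Fintype A] (φ : A →+ ℚ/ℤ) :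
    ∑ a, e (φ a) = if φ = 0 then (Fintype.card A : ℂ) else 0 := by
  have h : eChar.compAddMonoidHom φ = 0 ↔ φ = 0 := by
    rw [AddChar.eq_zero_iff, DFunLike.ext_iff]
    exact forall_congr' fun a ↦ e_eq_one_iff (φ a)
  simp only [← h]
  exact AddChar.sum_eq_ite (eChar.compAddMonoidHom φ)

/-- A subgroup equal to its own orthogonal complement. -/
def IsLagrangian (R : A →+ A →+ ℚ/ℤ) (G : AddSubgroup A) : Prop :=
  ∀ p, p ∈ G ↔ ∀ r ∈ G, R r p = 0

open Classical in
theorem IsLagrangian.sum_e {R : A →+ A →+ ℚ/ℤ} {G : AddSubgroup A} [Fintype G]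
    (hG : IsLagrangian R G) (p : A) :
    ∑ r : G, e (R r p) = if p ∈ G then (Fintype.card G : ℂ) else 0 := by
  have h : (R.flip p).comp G.subtype = 0 ↔ p ∈ G := by
    rw [hG, DFunLike.ext_iff]
    exact Subtype.forall
  simp only [← h]
  exact sum_e_hom ((R.flip p).comp G.subtype)

variable [Fintype A] [Fintype B]

open Classical in
theorem IsNondegSymm.sum_e {P : A →+ A →+ ℚ/ℤ} (hP : IsNondegSymm P) (b : A) :
    ∑ a, e (P a b) = if b = 0 then (Fintype.card A : ℂ) else 0 := by
  simp only [hP.symm _ b, sum_e_hom, map_eq_zero_iff P hP.injective]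

/-- The unitary Fourier transform on `ℂ[A]` with kernel `e(P(a, b))`. -/
def fourier (P : A →+ A →+ ℚ/ℤ) (v : A → ℂ) (b : A) : ℂ :=
  (√(Fintype.card A : ℝ) : ℂ)⁻¹ * ∑ a, e (P a b) * v a

theorem ofReal_sqrt_mul_self (n : ℕ) : (√(n : ℝ) : ℂ) * √(n : ℝ) = n := by
  rw [← Complex.ofReal_mul, Real.mul_self_sqrt n.cast_nonneg, Complex.ofReal_natCast]

theorem ofReal_sqrt_ne_zero {n : ℕ} (hn : n ≠ 0) : (√(n : ℝ) : ℂ) ≠ 0 := by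
  rw [Complex.ofReal_ne_zero, Real.sqrt_ne_zero']
  exact_mod_cast hn.pos

theorem sum_fourier_mul_fourier {P : A →+ A →+ ℚ/ℤ} (hP : IsNondegSymm P) (v w : A → ℂ) :
    ∑ b, fourier P v b * fourier (-P) w b = ∑ a, v a * w a := by
  classical
  have horth (a a' : A) : ∑ b, e (P a b) * e (-P a' b) =
      if a = a' then (Fintype.card A : ℂ) else 0 := by
    simp only [← e_add, ← sub_eq_add_neg, ← AddMonoidHom.sub_apply, ← map_sub, hP.symm (a - a'),
      hP.sum_e, sub_eq_zero]
  calc ∑ b, fourier P v b * fourier (-P) w b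
      = (Fintype.card A : ℂ)⁻¹ *
          ∑ b, ∑ a, ∑ a', e (P a b) * e (-P a' b) * (v a * w a') := by
        rw [← ofReal_sqrt_mul_self, mul_inv, Finset.mul_sum]
        refine Finset.sum_congr rfl fun b _ ↦ ?_
        rw [fourier, fourier, mul_mul_mul_comm, Finset.sum_mul_sum]
        refine congrArg _ (Finset.sum_congr rfl fun a _ ↦ Finset.sum_congr rfl fun a' _ ↦ ?_)
        exact mul_mul_mul_comm ..
    _ = (Fintype.card A : ℂ)⁻¹ *
          ∑ a, ∑ a', (∑ b, e (P a b) * e (-P a' b)) * (v a * w a') := by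
        simp only [Finset.sum_mul]
        rw [Finset.sum_comm, Finset.sum_congr rfl fun a _ ↦ Finset.sum_comm]
    _ = ∑ a, v a * w a := by
        simp only [horth, ite_mul, zero_mul, Finset.sum_ite_eq, Finset.mem_univ, if_true]
        rw [← Finset.mul_sum, inv_mul_cancel_left₀ (Nat.cast_ne_zero.mpr Fintype.card_ne_zero)]

theorem fourier_piPairing {ι : Type*} [Fintype ι] [DecidableEq ι] {A : ι → Type*}
    [∀ i, AddCommGroup (A i)] [∀ i, Fintype (A i)] (P : ∀ i, A i →+ A i →+ ℚ/ℤ)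
    (v : ∀ i, A i → ℂ) (b : ∀ i, A i) :
    fourier (piPairing P) (fun a ↦ ∏ i, v i (a i)) b = ∏ i, fourier (P i) (v i) (b i) := by
  simp only [fourier, piPairing_apply, e_sum, ← Finset.prod_mul_distrib, Finset.prod_univ_sum,
    Fintype.piFinset_univ, Finset.prod_mul_distrib (f := fun i ↦ (√(Fintype.card (A i) : ℝ) : ℂ)⁻¹),
    Finset.prod_inv_distrib]
  congr 2
  rw [Fintype.card_pi, Nat.cast_prod, Real.sqrt_prod _ fun _ _ ↦ Nat.cast_nonneg _,
    Complex.ofReal_prod]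

theorem IsLagrangian.sqrt_card {R : A →+ A →+ ℚ/ℤ} (hR : IsNondegSymm R) {G : AddSubgroup A}
    [Fintype G] (hG : IsLagrangian R G) : √(Fintype.card A : ℝ) = Fintype.card G := by
  classical
  rw [Real.sqrt_eq_iff_mul_self_eq (Nat.cast_nonneg _) (Nat.cast_nonneg _)]
  suffices (Fintype.card G : ℂ) * Fintype.card G = Fintype.card A by exact_mod_cast this.symm
  calc (Fintype.card G : ℂ) * Fintype.card G = ∑ p, ∑ r : G, e (R r p) := by
        simp only [hG.sum_e]
        rw [← Finset.sum_filter, Finset.sum_const, nsmul_eq_mul, ← Fintype.card_subtype]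
    _ = ∑ r : G, if r = 0 then (Fintype.card A : ℂ) else 0 := by
        rw [Finset.sum_comm]
        simp only [sum_e_hom, map_eq_zero_iff R hR.injective, ZeroMemClass.coe_eq_zero]
    _ = Fintype.card A := by simp

open Classical in
/-- The map `ℂ[B] → ℂ[A]` defined by a correspondence `G` between `A` and `B`. -/
def transfer (G : AddSubgroup (A × B)) (v : B → ℂ) (a : A) : ℂ :=
  ∑ b, if (a, b) ∈ G then v b else 0

section Transfer

variable {P : A →+ A →+ ℚ/ℤ} {Q : B →+ B →+ ℚ/ℤ} {G : AddSubgroup (A × B)}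

open Classical in
/- Expand the indicator of `G` as a sum of characters over `G` itself. -/
theorem IsLagrangian.card_mul_sum_e [Fintype G] (hP : IsNondegSymm P)
    (hG : IsLagrangian (prodPairing P (-Q)) G) (a : A) (b : B) :
    (Fintype.card G : ℂ) * ∑ a', (if (a', b) ∈ G then e (P a' a) else 0) =
      Fintype.card A * ∑ b', if (a, b') ∈ G then e (Q b' b) else 0 := by
  calc (Fintype.card G : ℂ) * ∑ a', (if (a', b) ∈ G then e (P a' a) else 0)
      = ∑ a', (∑ r : G, e (prodPairing P (-Q) r (a', b))) * e (P a' a) := by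
        simp only [Finset.mul_sum, hG.sum_e, ite_mul, zero_mul, mul_ite, mul_zero]
    _ = ∑ r : G, (∑ a', e (P a' (r.1.1 + a))) * e (-Q r.1.2 b) := by
        simp only [Finset.sum_mul]
        rw [Finset.sum_comm]
        refine Finset.sum_congr rfl fun r _ ↦ Finset.sum_congr rfl fun a' _ ↦ ?_
        rw [prodPairing_apply, map_add, e_add, e_add, hP.symm a' r.1.1, AddMonoidHom.neg_apply,
          AddMonoidHom.neg_apply]
        ring
    _ = ∑ r : G, if r.1.1 = -a then (Fintype.card A : ℂ) * e (-Q r.1.2 b) else 0 := by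
        simp only [hP.sum_e, ite_mul, zero_mul, add_eq_zero_iff_eq_neg]
    _ = ∑ b', if (-a, b') ∈ G then (Fintype.card A : ℂ) * e (-Q b' b) else 0 := by
        rw [← Finset.sum_subtype {p | p ∈ G} (by simp)
            fun p ↦ if p.1 = -a then (Fintype.card A : ℂ) * e (-Q p.2 b) else 0,
          Finset.sum_filter, Fintype.sum_prod_type, Finset.sum_eq_single (-a)]
        · simp
        · exact fun a' _ ha' ↦ Finset.sum_eq_zero fun b' _ ↦ by simp [ha']
        · simp
    _ = Fintype.card A * ∑ b', if (a, b') ∈ G then e (Q b' b) else 0 := by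
        rw [Finset.mul_sum, ← Equiv.sum_comp (Equiv.neg B)]
        refine Finset.sum_congr rfl fun b' _ ↦ ?_
        rw [Equiv.neg_apply, ← Prod.neg_mk, neg_mem_iff, map_neg, AddMonoidHom.neg_apply, neg_neg,
          mul_ite, mul_zero]

theorem IsLagrangian.fourier_transfer (hP : IsNondegSymm P) (hQ : IsNondegSymm Q)
    (hG : IsLagrangian (prodPairing P (-Q)) G) (v : B → ℂ) :
    fourier P (transfer G v) = transfer G (fourier Q v) := by
  classical
  funext a
  have hG₀ : (Fintype.card G : ℂ) ≠ 0 := Nat.cast_ne_zero.mpr Fintype.card_ne_zero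
  have hA := ofReal_sqrt_ne_zero (Fintype.card_ne_zero (α := A))
  have hB := ofReal_sqrt_ne_zero (Fintype.card_ne_zero (α := B))
  have hcard : (√(Fintype.card A : ℝ) : ℂ) * √(Fintype.card B : ℝ) = Fintype.card G := by
    rw [← Complex.ofReal_mul, ← Real.sqrt_mul (Nat.cast_nonneg _), ← Nat.cast_mul,
      ← Fintype.card_prod, hG.sqrt_card (hP.prod hQ.neg), Complex.ofReal_natCast]
  refine mul_left_cancel₀ hG₀ ?_
  calc (Fintype.card G : ℂ) * fourier P (transfer G v) a
      = (√(Fintype.card A : ℝ) : ℂ)⁻¹ * ∑ b,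
          (Fintype.card G * ∑ a', if (a', b) ∈ G then e (P a' a) else 0) * v b := by
        rw [fourier, mul_left_comm]
        simp only [transfer, Finset.mul_sum, Finset.sum_mul]
        rw [Finset.sum_comm]
        simp only [mul_ite, ite_mul, mul_zero, zero_mul, mul_assoc]
    _ = (√(Fintype.card A : ℝ) : ℂ)⁻¹ * Fintype.card A *
          ∑ b', if (a, b') ∈ G then ∑ b, e (Q b b') * v b else 0 := by
        simp only [hG.card_mul_sum_e hP, mul_assoc, ← Finset.mul_sum, Finset.sum_mul]
        rw [Finset.sum_comm]
        simp only [ite_mul, zero_mul, Finset.sum_ite_irrel, Finset.sum_const_zero, hQ.symm]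
    _ = (Fintype.card G : ℂ) * transfer G (fourier Q v) a := by
        simp only [transfer, fourier, ← mul_ite_zero, ← Finset.mul_sum]
        rw [← ofReal_sqrt_mul_self, ← hcard, inv_mul_cancel_left₀ hA, mul_assoc,
          mul_inv_cancel_left₀ hB]

end Transfer

end Pairings

/-! ### Theta series of residue classes -/

theorem qpow_zero (τ : ℍ) : qpow 0 τ = 1 := by simp [qpow]

theorem qpow_add (r s : ℚ) (τ : ℍ) : qpow (r + s) τ = qpow r τ * qpow s τ := by
  rw [qpow, qpow, qpow, ← Complex.exp_add]
  congr 1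
  push_cast
  ring

theorem qpow_sum {ι : Type*} (s : Finset ι) (r : ι → ℚ) (τ : ℍ) :
    qpow (∑ i ∈ s, r i) τ = ∏ i ∈ s, qpow (r i) τ := by
  classical
  induction s using Finset.induction_on with
  | empty => simp [qpow_zero]
  | insert i s hi ih => rw [Finset.sum_insert hi, Finset.prod_insert hi, qpow_add, ih]

theorem norm_qpow (r : ℚ) (τ : ℍ) : ‖qpow r τ‖ = Real.exp (-(2 * Real.pi * r * τ.im)) := by
  rw [qpow, Complex.norm_exp, show (2 * Real.pi * Complex.I * (r : ℂ) * (τ : ℂ))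
    = ((2 * Real.pi * r : ℝ) : ℂ) * (Complex.I * τ) by push_cast; ring, Complex.re_ofReal_mul,
    Complex.I_mul_re, coe_im, mul_neg]

theorem tendsto_norm_qpow_neg_one : Tendsto (norm ∘ qpow (-1)) atImInfty atTop := by
  have hq : norm ∘ qpow (-1) = fun τ : ℍ ↦ Real.exp (2 * Real.pi * τ.im) := by
    funext τ
    rw [Function.comp_apply, norm_qpow]
    congr 1
    push_cast
    ring
  rw [hq]
  exact Real.tendsto_exp_atTop.comp (tendsto_comap.const_mul_atTop Real.two_pi_pos)

theorem mdifferentiable_fun_sum {ι : Type*} {s : Finset ι} {f : ι → ℍ → ℂ}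
    (hf : ∀ i ∈ s, MDifferentiable 𝓘(ℂ) 𝓘(ℂ) (f i)) :
    MDifferentiable 𝓘(ℂ) 𝓘(ℂ) fun τ ↦ ∑ i ∈ s, f i τ := by
  simp_rw [UpperHalfPlane.mdifferentiable_iff] at hf ⊢
  exact DifferentiableOn.fun_sum hf

theorem mdifferentiable_fun_prod {ι : Type*} {s : Finset ι} {f : ι → ℍ → ℂ}
    (hf : ∀ i ∈ s, MDifferentiable 𝓘(ℂ) 𝓘(ℂ) (f i)) :
    MDifferentiable 𝓘(ℂ) 𝓘(ℂ) fun τ ↦ ∏ i ∈ s, f i τ := by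
  simp_rw [UpperHalfPlane.mdifferentiable_iff] at hf ⊢
  exact DifferentiableOn.fun_finsetProd hf

theorem mdifferentiable_qpow (r : ℚ) : MDifferentiable 𝓘(ℂ) 𝓘(ℂ) (qpow r) := by
  rw [UpperHalfPlane.mdifferentiable_iff]
  refine DifferentiableOn.congr (f := fun z ↦ Complex.exp (2 * Real.pi * Complex.I * (r : ℂ) * z))
    (by fun_prop) fun z hz ↦ ?_
  rw [Function.comp_apply, qpow, ofComplex_apply_of_im_pos hz]

/-- The theta series `∑_{m ≡ b mod N} q^{m²/2N}`. -/
def cosetTheta (N : ℕ) (b : ZMod N) (τ : ℍ) : ℂ :=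
  ∑' m : ℤ, if (m : ZMod N) = b then qpow (m ^ 2 / (2 * N)) τ else 0

/-- The pairing `(b, c) ↦ bc/N` on `ℤ/N`. -/
def zmodPairing (N : ℕ) [NeZero N] : ZMod N →+ ZMod N →+ ℚ/ℤ :=
  (AddMonoidHom.mul (R := ZMod N)).compr₂ <| ZMod.lift N
    ⟨(QuotientAddGroup.mk' _).comp (AddMonoidHom.mulRight (N⁻¹ : ℚ) |>.comp (Int.castAddHom ℚ)), by
      have hN : (N : ℚ) ≠ 0 := Nat.cast_ne_zero.mpr (NeZero.ne N)
      simp [hN]⟩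

section

variable (N : ℕ) [NeZero N]

theorem zmodPairing_intCast (m n : ℤ) :
    zmodPairing N m n = ((m * n / N : ℚ) : ℚ/ℤ) := by
  rw [zmodPairing, AddMonoidHom.compr₂_apply, AddMonoidHom.mul_apply, ← Int.cast_mul,
    ZMod.lift_coe, div_eq_mul_inv]
  exact congrArg (fun x : ℚ ↦ ((x * (N : ℚ)⁻¹ : ℚ) : ℚ/ℤ)) (Int.cast_mul m n)

theorem isNondegSymm_zmodPairing : IsNondegSymm (zmodPairing N) where
  symm b c := by
    rw [zmodPairing, AddMonoidHom.compr₂_apply, AddMonoidHom.compr₂_apply, AddMonoidHom.mul_apply,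
      AddMonoidHom.mul_apply, mul_comm]
  injective := by
    refine (injective_iff_map_eq_zero _).mpr fun b hb ↦ ?_
    obtain ⟨m, rfl⟩ := ZMod.intCast_surjective b
    have hN : (N : ℚ) ≠ 0 := Nat.cast_ne_zero.mpr (NeZero.ne N)
    have h : zmodPairing N m (1 : ℤ) = 0 := by rw [hb, AddMonoidHom.zero_apply]
    rw [zmodPairing_intCast, AddCircle.coe_eq_zero_iff] at h
    obtain ⟨k, hk⟩ := h
    rw [ZMod.intCast_zmod_eq_zero_iff_dvd]
    refine ⟨k, ?_⟩
    rw [zsmul_one, Int.cast_one, mul_one, eq_div_iff hN] at hk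
    rw [mul_comm]
    exact_mod_cast hk.symm

theorem qpow_sq_div_eq_jacobiTheta₂_term (m : ℤ) (τ : ℍ) :
    qpow (m ^ 2 / (2 * N)) τ = jacobiTheta₂_term m 0 (τ / N) := by
  have hN : (N : ℂ) ≠ 0 := Nat.cast_ne_zero.mpr (NeZero.ne N)
  rw [qpow, jacobiTheta₂_term]
  congr 1
  push_cast
  field_simp
  ring

theorem summable_norm_qpow_sq_div (τ : ℍ) :
    Summable fun m : ℤ ↦ ‖qpow (m ^ 2 / (2 * N)) τ‖ := by
  simp only [qpow_sq_div_eq_jacobiTheta₂_term]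
  refine ((summable_jacobiTheta₂_term_iff 0 (τ / N)).mpr ?_).norm
  rw [Complex.div_natCast_im]
  exact div_pos τ.im_pos (Nat.cast_pos.mpr (NeZero.pos N))

theorem summable_norm_cosetTheta (b : ZMod N) (τ : ℍ) :
    Summable fun m : ℤ ↦ ‖if (m : ZMod N) = b then qpow (m ^ 2 / (2 * N)) τ else 0‖ := by
  refine (summable_norm_qpow_sq_div N τ).of_nonneg_of_le (fun _ ↦ norm_nonneg _) fun m ↦ ?_
  split_ifs <;> simp

theorem cosetTheta_eq_jacobiTheta₂ (b : ZMod N) (τ : ℍ) :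
    cosetTheta N b τ = qpow (b.val ^ 2 / (2 * N)) τ * jacobiTheta₂ (b.val * τ) (N * τ) := by
  have hN : (N : ℂ) ≠ 0 := Nat.cast_ne_zero.mpr (NeZero.ne N)
  have hinj : Function.Injective (fun j : ℤ ↦ (b.val : ℤ) + N * j) := fun i j h ↦ by
    simpa [NeZero.ne N] using h
  rw [cosetTheta, jacobiTheta₂, ← tsum_mul_left, ← hinj.tsum_eq]
  · refine tsum_congr fun j ↦ ?_
    rw [if_pos (by simp), qpow, qpow, jacobiTheta₂_term, ← Complex.exp_add]
    congr 1
    push_cast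
    field_simp
    ring
  · intro m hm
    have hmb : (m : ZMod N) = b := by_contra fun h ↦ hm (if_neg h)
    obtain ⟨j, hj⟩ := (ZMod.intCast_zmod_eq_zero_iff_dvd (m - b.val) N).mp (by simp [hmb])
    exact ⟨j, by dsimp only; omega⟩

theorem mdifferentiable_cosetTheta (b : ZMod N) :
    MDifferentiable 𝓘(ℂ) 𝓘(ℂ) (cosetTheta N b) := by
  rw [funext (cosetTheta_eq_jacobiTheta₂ N b)]
  refine (mdifferentiable_qpow _).mul (UpperHalfPlane.mdifferentiable_iff.mpr fun z hz ↦ ?_)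
  have him : 0 < ((N : ℂ) * z).im := by
    rw [← Complex.ofReal_natCast, Complex.im_ofReal_mul]
    exact mul_pos (Nat.cast_pos.mpr (NeZero.pos N)) hz
  have hcomp : DifferentiableAt ℂ (fun z : ℂ ↦ jacobiTheta₂ (b.val * z) (N * z)) z :=
    DifferentiableAt.comp (f := fun z : ℂ ↦ ((b.val : ℂ) * z, (N : ℂ) * z))
      (g := fun p : ℂ × ℂ ↦ jacobiTheta₂ p.1 p.2) z
      (hasFDerivAt_jacobiTheta₂ (b.val * z) him).differentiableAt (by fun_prop)
  have hcongr {w : ℂ} (hw : 0 < w.im) :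
      ((fun τ : ℍ ↦ jacobiTheta₂ (b.val * τ) (N * τ)) ∘ ofComplex) w =
        jacobiTheta₂ (b.val * w) (N * w) := by
    rw [Function.comp_apply, ofComplex_apply_of_im_pos hw]
  exact hcomp.differentiableWithinAt.congr (fun w hw ↦ hcongr hw) (hcongr hz)

theorem norm_cosetTheta_le (b : ZMod N) {τ : ℍ} (hτ : 1 ≤ τ.im) :
    ‖cosetTheta N b τ‖ ≤ ∑' m : ℤ, ‖qpow (m ^ 2 / (2 * N)) I‖ := by
  refine (norm_tsum_le_tsum_norm (summable_norm_cosetTheta N b τ)).trans <|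
    (summable_norm_cosetTheta N b τ).tsum_le_tsum (fun m ↦ ?_) (summable_norm_qpow_sq_div N I)
  split_ifs
  · rw [norm_qpow, norm_qpow, Real.exp_le_exp, I_im, neg_le_neg_iff]
    gcongr
  · simp

theorem sum_e_mul_cosetTheta (b : ZMod N) (τ : ℍ) :
    ∑ c, e ((-zmodPairing N) c b) * cosetTheta N c τ = jacobiTheta₂ (b.val / N) (τ / N) := by
  have he (m : ℤ) : e ((-zmodPairing N) m b) =
      Complex.exp (-(2 * Real.pi * Complex.I * (m * b.val / N))) := by
    have hb : b = ((b.val : ℤ) : ZMod N) := by simp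
    rw [AddMonoidHom.neg_apply, AddMonoidHom.neg_apply, congrArg (zmodPairing N m) hb,
      zmodPairing_intCast, ← AddCircle.coe_neg, e_coe]
    congr 1
    push_cast
    ring
  simp only [cosetTheta, ← tsum_mul_left]
  rw [← jacobiTheta₂_neg_left, jacobiTheta₂,
    ← Summable.tsum_finsetSum fun c _ ↦ (summable_norm_cosetTheta N c τ).of_norm.mul_left _]
  refine tsum_congr fun m ↦ ?_
  rw [Finset.sum_eq_single (m : ZMod N) (fun c _ hc ↦ by rw [if_neg hc.symm, mul_zero])
    (by simp), if_pos rfl, he, qpow, jacobiTheta₂_term, ← Complex.exp_add]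
  congr 1
  push_cast
  ring

theorem cpow_half_div_natCast {z : ℂ} (hz : z ≠ 0) :
    (z / (N : ℂ)) ^ (1 / 2 : ℂ) = z ^ (1 / 2 : ℂ) / (√(N : ℝ) : ℂ) := by
  have hN : (0 : ℝ) < N := Nat.cast_pos.mpr (NeZero.pos N)
  have hN₀ : (N : ℂ) ≠ 0 := Nat.cast_ne_zero.mpr (NeZero.ne N)
  have hlog : Complex.log (z / N) = Complex.log z - Complex.log N := by
    rw [div_eq_inv_mul, ← Complex.ofReal_natCast, ← Complex.ofReal_inv,
      Complex.log_ofReal_mul (inv_pos.mpr hN) hz, Real.log_inv, Complex.ofReal_neg,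
      Complex.ofReal_log hN.le, neg_add_eq_sub]
  rw [Real.sqrt_eq_rpow, Complex.ofReal_cpow hN.le, Complex.ofReal_natCast,
    Complex.cpow_def_of_ne_zero (div_ne_zero hz hN₀), Complex.cpow_def_of_ne_zero hz,
    Complex.cpow_def_of_ne_zero hN₀, hlog, sub_mul, Complex.exp_sub]
  norm_num

theorem cosetTheta_S_smul (b : ZMod N) (τ : ℍ) :
    cosetTheta N b (ModularGroup.S • τ) = (-Complex.I * τ) ^ (1 / 2 : ℂ) *
      fourier (-zmodPairing N) (fun c ↦ cosetTheta N c τ) b := by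
  have hN : (N : ℂ) ≠ 0 := Nat.cast_ne_zero.mpr (NeZero.ne N)
  have hτ : (τ : ℂ) ≠ 0 := ne_zero τ
  have hIτ : -Complex.I * τ ≠ 0 := mul_ne_zero (neg_ne_zero.mpr Complex.I_ne_zero) hτ
  have hs : (-Complex.I * τ) ^ (1 / 2 : ℂ) / (√(N : ℝ) : ℂ) ≠ 0 := by
    rw [← cpow_half_div_natCast N hIτ]
    exact Complex.cpow_ne_zero_iff.mpr (Or.inl (div_ne_zero hIτ hN))
  rw [fourier, sum_e_mul_cosetTheta, ZMod.card, ← mul_assoc, ← div_eq_mul_inv,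
    jacobiTheta₂_functional_equation, ← mul_div_assoc, cpow_half_div_natCast N hIτ,
    cosetTheta_eq_jacobiTheta₂, ← mul_assoc, ← mul_assoc, mul_one_div_cancel hs, one_mul,
    ← jacobiTheta₂_neg_left, modular_S_smul, qpow]
  simp only [inv_neg]
  congr 2
  · push_cast
    field_simp
  · field_simp
  · field_simp

end

theorem hasSum_pi_prod {n : ℕ} {g : Fin n → ℤ → ℂ} (hg : ∀ i, Summable fun m ↦ ‖g i m‖) :
    (Summable fun m : Fin n → ℤ ↦ ‖∏ i, g i (m i)‖) ∧
      HasSum (fun m : Fin n → ℤ ↦ ∏ i, g i (m i)) (∏ i, ∑' m, g i m) := by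
  induction n with
  | zero => exact ⟨Summable.of_finite, by simp⟩
  | succ n ih =>
    obtain ⟨h₁, h₂⟩ := ih fun i ↦ hg i.succ
    let E : ℤ × (Fin n → ℤ) ≃ (Fin (n + 1) → ℤ) := Fin.consEquiv fun _ ↦ ℤ
    have hE (x : ℤ × (Fin n → ℤ)) : ∏ i, g i (E x i) = g 0 x.1 * ∏ i, g i.succ (x.2 i) :=
      Fin.prod_univ_succ _
    have hsum : Summable fun m : Fin (n + 1) → ℤ ↦ ‖∏ i, g i (m i)‖ :=
      E.summable_iff.mp <| ((hg 0).mul_norm h₁).congr fun x ↦ by rw [Function.comp_apply, hE]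
    refine ⟨hsum, ?_⟩
    rw [hsum.of_norm.hasSum_iff, Fin.prod_univ_succ, ← h₂.tsum_eq,
      tsum_mul_tsum_of_summable_norm (hg 0) h₁, ← E.tsum_eq]
    exact tsum_congr hE

open Classical in
theorem hasSum_prod_qpow_sq_div {n : ℕ} (N : Fin n → ℕ) [∀ i, NeZero (N i)]
    (s : Set (∀ i, ZMod (N i))) (τ : ℍ) :
    HasSum (fun m : Fin n → ℤ ↦ if (fun i ↦ (m i : ZMod (N i))) ∈ s
        then ∏ i, qpow (m i ^ 2 / (2 * N i)) τ else 0)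
      (∑ b, if b ∈ s then ∏ i, cosetTheta (N i) (b i) τ else 0) := by
  have h (b : ∀ i, ZMod (N i)) : HasSum (fun m : Fin n → ℤ ↦ if b ∈ s then
      ∏ i, (if (m i : ZMod (N i)) = b i then qpow (m i ^ 2 / (2 * N i)) τ else 0) else 0)
      (if b ∈ s then ∏ i, cosetTheta (N i) (b i) τ else 0) := by
    split_ifs with hb
    · exact (hasSum_pi_prod fun i ↦ summable_norm_cosetTheta (N i) (b i) τ).2
    · exact hasSum_zero
  refine (hasSum_sum fun b _ ↦ h b).congr_fun fun m ↦ ?_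
  rw [Finset.sum_eq_single (fun i ↦ (m i : ZMod (N i)))]
  · simp
  · intro b _ hb
    obtain ⟨i, hi⟩ := Function.ne_iff.mp hb
    rw [Finset.prod_eq_zero (Finset.mem_univ i) (if_neg hi.symm), ite_self]
  · simp

/-! ### Lattices in rational quadratic spaces -/

section

theorem span_int_range_coe {V ι : Type*} [AddCommGroup V] {N : Submodule ℤ V}
    (b : Module.Basis ι ℤ N) : Submodule.span ℤ (Set.range fun i ↦ (b i : V)) = N := by
  have h : (Set.range fun i ↦ (b i : V)) = N.subtype '' Set.range b := Set.range_comp N.subtype b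
  rw [h, Submodule.span_image, b.span_eq, Submodule.map_top, Submodule.range_subtype]

variable {V : Type*} [AddCommGroup V] [Module ℚ V]

theorem linearIndependent_rat_coe {ι : Type*} {N : Submodule ℤ V} (b : Module.Basis ι ℤ N) :
    LinearIndependent ℚ fun i ↦ (b i : V) := by
  rw [← LinearIndependent.iff_fractionRing ℤ ℚ]
  exact b.linearIndependent.map' N.subtype N.ker_subtype

theorem span_rat_range_coe {ι : Type*} {N : Submodule ℤ V} (b : Module.Basis ι ℤ N) :
    Submodule.span ℚ (Set.range fun i ↦ (b i : V)) = Submodule.span ℚ (N : Set V) := by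
  rw [← Submodule.span_span_of_tower ℤ ℚ, span_int_range_coe b]

theorem finrank_span_rat {N : Submodule ℤ V} (hN : N.FG) :
    Module.finrank ℚ (Submodule.span ℚ (N : Set V)) = Module.finrank ℤ N := by
  have : Module.Finite ℤ N := Module.Finite.iff_fg.mpr hN
  have : IsAddTorsionFree V := IsAddTorsionFree.of_module_rat V
  let b := Module.finBasis ℤ N
  rw [← span_rat_range_coe b, finrank_span_eq_card (linearIndependent_rat_coe b), Fintype.card_fin]

theorem exists_rat_basis_span_int_eq {N : Submodule ℤ V} (hN : N.FG)
    (hspan : Submodule.span ℚ (N : Set V) = ⊤) :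
    ∃ (n : ℕ) (b : Module.Basis (Fin n) ℚ V), Submodule.span ℤ (Set.range b) = N := by
  have : Module.Finite ℤ N := Module.Finite.iff_fg.mpr hN
  have : IsAddTorsionFree V := IsAddTorsionFree.of_module_rat V
  let b := Module.finBasis ℤ N
  refine ⟨_, Module.Basis.mk (linearIndependent_rat_coe b) ?_, ?_⟩
  · rw [span_rat_range_coe b, hspan]
  · rw [Module.Basis.coe_mk, span_int_range_coe b]

theorem exists_form_eq [FiniteDimensional ℚ V] {B : LinearMap.BilinForm ℚ V}
    (hB : B.Nondegenerate) {N : Submodule ℤ V} (φ : N →ₗ[ℤ] ℚ) :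
    ∃ y : V, ∀ x : N, B y x = φ x := by
  have hbaer : Module.Baer ℤ ℚ := Module.Baer.of_divisible ℚ
  obtain ⟨ψ, hψ⟩ := hbaer.extension_property N.subtype N.injective_subtype φ
  refine ⟨(B.toDual hB).symm ψ.toAddMonoidHom.toRatLinearMap, fun x ↦ ?_⟩
  rw [LinearMap.BilinForm.apply_toDual_symm_apply]
  exact LinearMap.congr_fun hψ x

theorem exists_retraction_inf {N : Submodule ℤ V} (hN : N.FG) (P : Submodule ℚ V) :
    ∃ r : N →ₗ[ℤ] N, (∀ x, (r x : V) ∈ P) ∧ ∀ x : N, (x : V) ∈ P → r x = x := by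
  have : Module.Finite ℤ N := Module.Finite.iff_fg.mpr hN
  have : IsAddTorsionFree (V ⧸ P) := IsAddTorsionFree.of_module_rat (V ⧸ P)
  let f : N →ₗ[ℤ] V ⧸ P := P.mkQ.restrictScalars ℤ ∘ₗ N.subtype
  obtain ⟨s, hs⟩ := Module.projective_lifting_property f.rangeRestrict LinearMap.id
    f.surjective_rangeRestrict
  have hfs (y) : f (s y) = y := congrArg Subtype.val (LinearMap.congr_fun hs y)
  refine ⟨LinearMap.id - s ∘ₗ f.rangeRestrict, fun x ↦ ?_, fun x hx ↦ ?_⟩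
  · have h : f (x - s (f.rangeRestrict x)) = 0 := by
      rw [map_sub, hfs]
      exact sub_self (f x)
    exact (Submodule.Quotient.mk_eq_zero P).mp h
  · have h : f.rangeRestrict x = 0 := Subtype.ext ((Submodule.Quotient.mk_eq_zero P).mpr hx)
    rw [LinearMap.sub_apply, LinearMap.id_apply, LinearMap.comp_apply, h, map_zero, sub_zero]

end

namespace EvenLattice

variable {V : Type*} [AddCommGroup V] [Module ℚ V] (L : EvenLattice V)

theorem mem_dual_iff {x : V} : x ∈ L.dual ↔ ∀ y ∈ L.carrier, ∃ n : ℤ, L.form x y = n := by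
  refine forall₂_congr fun y _ ↦ ?_
  rw [Submodule.mem_one]
  simp [eq_comm]

theorem form_comm (x y : V) : L.form x y = L.form y x := (L.symm.eq y x).symm

theorem carrier_le_dual : L.carrier ≤ L.dual := by
  intro x hx
  rw [L.mem_dual_iff]
  intro y hy
  obtain ⟨a, ha⟩ := L.even x hx
  obtain ⟨b, hb⟩ := L.even y hy
  obtain ⟨c, hc⟩ := L.even _ (add_mem hx hy)
  refine ⟨c - a - b, ?_⟩
  have h := L.form_comm x y
  simp only [map_add, LinearMap.add_apply] at hc
  push_cast
  linarith

theorem mem_carrier_of_form_dual {x : V} (h : ∀ y ∈ L.dual, ∃ n : ℤ, L.form x y = n) :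
    x ∈ L.carrier := by
  obtain ⟨n, b, hb⟩ := exists_rat_basis_span_int_eq L.fg L.span_eq_top
  have hdual := LinearMap.BilinForm.dualSubmodule_dualSubmodule_of_basis (R := ℤ) L.form L.nondeg
    L.symm b
  rw [hb] at hdual
  rw [← hdual]
  intro y hy
  obtain ⟨n, hn⟩ := h y hy
  exact Submodule.mem_one.mpr ⟨n, by simp [hn]⟩

theorem cls_surjective : Function.Surjective L.cls := Submodule.Quotient.mk_surjective _

theorem cls_add (x y : L.dual) : L.cls (x + y) = L.cls x + L.cls y := rfl

theorem cls_eq_cls_iff {x y : L.dual} : L.cls x = L.cls y ↔ (x : V) - y ∈ L.carrier :=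
  Submodule.Quotient.eq _

theorem cls_eq_zero_iff {x : L.dual} : L.cls x = 0 ↔ (x : V) ∈ L.carrier :=
  Submodule.Quotient.mk_eq_zero _

theorem q_cls (x : L.dual) : L.q (L.cls x) = ((L.form x x / 2 : ℚ) : ℚ/ℤ) := rfl

theorem pair_cls (x y : L.dual) : L.pair (L.cls x) (L.cls y) = (L.form x y : ℚ/ℤ) := rfl

theorem pair_comm (a b : L.A) : L.pair a b = L.pair b a := by
  obtain ⟨x, rfl⟩ := L.cls_surjective a
  obtain ⟨y, rfl⟩ := L.cls_surjective b
  rw [pair_cls, pair_cls, L.form_comm]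

theorem pair_add (a b c : L.A) : L.pair a (b + c) = L.pair a b + L.pair a c := by
  obtain ⟨x, rfl⟩ := L.cls_surjective a
  obtain ⟨y, rfl⟩ := L.cls_surjective b
  obtain ⟨z, rfl⟩ := L.cls_surjective c
  rw [← cls_add, pair_cls, pair_cls, pair_cls, Submodule.coe_add, map_add, AddCircle.coe_add]

/-- The discriminant bilinear form `pair` as a biadditive map. -/
def pairHom : L.A →+ L.A →+ ℚ/ℤ :=
  .mk' (fun a ↦ .mk' (L.pair a) (L.pair_add a)) fun a b ↦ by
    ext c
    simp only [AddMonoidHom.mk'_apply, AddMonoidHom.add_apply, L.pair_comm _ c, pair_add]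

theorem pairHom_apply (a b : L.A) : L.pairHom a b = L.pair a b := rfl

theorem isNondegSymm_pairHom : IsNondegSymm L.pairHom where
  symm := L.pair_comm
  injective := by
    refine (injective_iff_map_eq_zero _).mpr fun a ha ↦ ?_
    obtain ⟨x, rfl⟩ := L.cls_surjective a
    refine L.cls_eq_zero_iff.mpr (L.mem_carrier_of_form_dual fun y hy ↦ ?_)
    have h : L.pair (L.cls x) (L.cls ⟨y, hy⟩) = 0 := DFunLike.congr_fun ha (L.cls ⟨y, hy⟩)
    obtain ⟨n, hn⟩ := (AddCircle.coe_eq_zero_iff 1).mp h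
    exact ⟨n, by rw [← hn, zsmul_one]⟩

theorem finrank_eq_sigP_add_sigQ : Module.finrank ℚ V = L.sigP + L.sigQ := by
  have := L.finiteDimensional
  have hrad : QuadraticMap.radical L.form.toQuadraticMap = ⊥ := by
    rw [eq_bot_iff]
    intro x hx
    rw [QuadraticMap.mem_radical_iff'] at hx
    refine (Submodule.mem_bot ℚ).mpr (L.nondeg.1 x fun y ↦ ?_)
    have hxx := hx.1
    have hxy := hx.2 y
    have hcomm := L.form_comm x y
    simp only [LinearMap.BilinMap.toQuadraticMap_apply, map_add, LinearMap.add_apply] at hxx hxy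
    linarith
  have h := QuadraticForm.sigPos_add_sigNeg_add_radical (Q := L.form.toQuadraticMap)
  rw [hrad, finrank_bot] at h
  exact h.symm

namespace MaximalIsotropic

variable {L} (I : L.MaximalIsotropic)

theorem finrank_rat : Module.finrank ℚ I.rat = L.sigP :=
  (finrank_span_rat (L.fg.of_le I.le)).trans I.finrank_eq

theorem rat_le_perp : I.rat ≤ I.perp := fun _ hx _ hy ↦ I.rat_isotropic hy hx

theorem mem_rat_of_form_perp {x : V} (h : ∀ y ∈ I.perp, L.form y x = 0) : x ∈ I.rat := by
  have := L.finiteDimensional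
  have hx : x ∈ L.form.orthogonal (L.form.orthogonal I.rat) := h
  rwa [LinearMap.BilinForm.orthogonal_orthogonal L.nondeg L.symm.isRefl] at hx

theorem finrank_W : (Module.finrank ℚ I.W : ℤ) = -L.sigma := by
  have := L.finiteDimensional
  have hquot : Module.finrank ℚ I.W + _ = _ :=
    (I.rat.submoduleOf I.perp).finrank_quotient_add_finrank
  have hperp : Module.finrank ℚ I.perp = Module.finrank ℚ V - Module.finrank ℚ I.rat :=
    LinearMap.BilinForm.finrank_orthogonal L.nondeg I.rat
  rw [(Submodule.submoduleOfEquivOfLe I.rat_le_perp).finrank_eq, I.finrank_rat] at hquot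
  rw [I.finrank_rat, L.finrank_eq_sigP_add_sigQ] at hperp
  rw [sigma]
  omega

theorem form_neg_of_perp {x : V} (hx : x ∈ I.perp) (hx' : x ∉ I.rat) : L.form x x < 0 := by
  have := L.finiteDimensional
  by_contra! hneg
  have hx₀ : x ≠ 0 := fun h ↦ hx' (h ▸ zero_mem _)
  have hdim : Module.finrank ℚ (I.rat ⊔ Submodule.span ℚ {x} : Submodule ℚ V) = L.sigP + 1 := by
    have h := Submodule.finrank_sup_add_finrank_inf_eq I.rat (Submodule.span ℚ {x})
    rwa [((Submodule.disjoint_span_singleton' hx₀).mpr hx').eq_bot, finrank_bot, I.finrank_rat,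
      finrank_span_singleton hx₀] at h
  have hsemi : ∀ y ∈ I.rat ⊔ Submodule.span ℚ {x}, (-L.form.toQuadraticMap) y ≤ 0 := by
    intro y hy
    obtain ⟨i, hi, z, hz, rfl⟩ := Submodule.mem_sup.mp hy
    obtain ⟨c, rfl⟩ := Submodule.mem_span_singleton.mp hz
    simp only [_root_.neg_apply, LinearMap.BilinMap.toQuadraticMap_apply, map_add,
      LinearMap.add_apply, map_smul, LinearMap.smul_apply, smul_eq_mul, I.rat_isotropic hi hi,
      I.form_perp_left hi hx, I.form_perp_right hx hi]
    nlinarith [mul_nonneg (mul_self_nonneg c) hneg]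
  have h := QuadraticForm.sigPos_add_finrank_le_of_nonpos hsemi
  rw [sigPos_neg, hdim, L.finrank_eq_sigP_add_sigQ] at h
  change L.sigQ + _ ≤ _ at h
  omega

theorem proj_eq_zero_iff {x : I.perp} : I.proj x = 0 ↔ (x : V) ∈ I.rat :=
  Submodule.Quotient.mk_eq_zero _

theorem formW_neg {k : I.W} (hk : k ≠ 0) : I.formW k k < 0 := by
  obtain ⟨x, rfl⟩ := I.proj_surjective k
  exact I.form_neg_of_perp x.2 fun h ↦ hk (I.proj_eq_zero_iff.mpr h)

theorem proj_mem_K {x : I.perp} (hx : (x : V) ∈ L.carrier) : I.proj x ∈ I.K.carrier := ⟨x, hx, rfl⟩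

theorem proj_mem_K_dual {x : I.perp} (hx : (x : V) ∈ L.dual) : I.proj x ∈ I.K.dual := by
  rw [mem_dual_iff]
  rintro _ ⟨y, hy, rfl⟩
  exact L.dual_pair hx hy

theorem mem_perp_of_form_carrier {x : V} (h : ∀ y ∈ I.carrier, L.form y x = 0) : x ∈ I.perp :=
  Submodule.span_le (p := LinearMap.ker (L.form.flip x)).mpr h

theorem exists_proj_eq_of_mem_K_dual {k : I.W} (hk : k ∈ I.K.dual) :
    ∃ x : I.perp, (x : V) ∈ L.dual ∧ I.proj x = k := by
  have := L.finiteDimensional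
  obtain ⟨x, rfl⟩ := I.proj_surjective k
  obtain ⟨r, hr, hr'⟩ := exists_retraction_inf L.fg I.perp
  obtain ⟨y, hy⟩ := exists_form_eq L.nondeg
    ((L.form x).restrictScalars ℤ ∘ₗ L.carrier.subtype ∘ₗ r)
  replace hy (l : L.carrier) : L.form y l = L.form x (r l) := hy l
  have hyL : y ∈ L.dual := by
    rw [mem_dual_iff]
    intro l hl
    rw [hy ⟨l, hl⟩]
    exact I.K.dual_pair hk (I.proj_mem_K (x := ⟨r ⟨l, hl⟩, hr _⟩) (r ⟨l, hl⟩).2)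
  have hyx : y - x ∈ I.rat := by
    refine I.mem_rat_of_form_perp fun z hz ↦ ?_
    obtain ⟨m, hm, hmz⟩ := L.exists_smul_mem z
    have h := hy ⟨m • z, hmz⟩
    rw [hr' ⟨m • z, hmz⟩ (I.perp.toAddSubgroup.zsmul_mem hz m)] at h
    simp only [map_zsmul, zsmul_eq_mul, mul_right_inj' (Int.cast_ne_zero (α := ℚ).mpr hm)] at h
    rw [L.form_comm, map_sub, LinearMap.sub_apply, h, sub_self]
  have hyI : y ∈ I.perp := by
    simpa only [sub_add_cancel] using I.perp.add_mem (I.rat_le_perp hyx) x.2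
  refine ⟨⟨y, hyI⟩, hyL, ?_⟩
  rw [← sub_eq_zero, ← map_sub, proj_eq_zero_iff]
  exact hyx

theorem carrier_le_star : I.carrier ≤ I.star := fun _ hx ↦
  ⟨Submodule.subset_span hx, L.carrier_le_dual (I.le hx)⟩

theorem exists_sub_mem_perp {z : V} (h : ∀ y ∈ I.star, ∃ n : ℤ, L.form z y = n) :
    ∃ l ∈ L.carrier, z - l ∈ I.perp := by
  have := L.finiteDimensional
  obtain ⟨r, hr, hr'⟩ := exists_retraction_inf L.dual_fg I.rat
  obtain ⟨l, hl⟩ := exists_form_eq L.nondeg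
    ((L.form z).restrictScalars ℤ ∘ₗ L.dual.subtype ∘ₗ r)
  replace hl (y : L.dual) : L.form l y = L.form z (r y) := hl y
  refine ⟨l, L.mem_carrier_of_form_dual fun y hy ↦ ?_, ?_⟩
  · rw [hl ⟨y, hy⟩]
    exact h _ ⟨hr _, (r ⟨y, hy⟩).2⟩
  · refine I.mem_perp_of_form_carrier fun y hy ↦ ?_
    obtain ⟨hyI, hyL⟩ := I.carrier_le_star hy
    rw [L.form_comm, map_sub, LinearMap.sub_apply, hl ⟨y, hyL⟩, hr' ⟨y, hyL⟩ hyI, sub_self]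

end MaximalIsotropic

end EvenLattice

theorem sum_ite_eq_ite_exists {ι M : Type*} [Fintype ι] [AddCommMonoid M] {p : ι → Prop}
    [DecidablePred p] [Decidable (∃ i, p i)] (hp : ∀ i j, p i → p j → i = j) (c : M) :
    (∑ i, if p i then c else 0) = if ∃ i, p i then c else 0 := by
  classical
  split_ifs with h
  · obtain ⟨i, hi⟩ := h
    rw [Finset.sum_eq_single_of_mem i (Finset.mem_univ i), if_pos hi]
    exact fun j _ hj ↦ if_neg fun h ↦ hj (hp j i h hi)
  · exact Finset.sum_eq_zero fun i _ ↦ if_neg fun hi ↦ h ⟨i, hi⟩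

section Transfer

variable {A B : Type*} [AddCommGroup A] [AddCommGroup B] [Fintype B] {G : AddSubgroup (A × B)}

theorem mdifferentiable_transfer {v : ℍ → B → ℂ}
    (hv : ∀ b, MDifferentiable 𝓘(ℂ) 𝓘(ℂ) fun τ ↦ v τ b) (a : A) :
    MDifferentiable 𝓘(ℂ) 𝓘(ℂ) fun τ ↦ transfer G (v τ) a := by
  classical
  refine mdifferentiable_fun_sum fun b _ ↦ ?_
  split_ifs
  · exact hv b
  · exact mdifferentiable_const

theorem isBigO_transfer {X : Type*} {l : Filter X} {v : X → B → ℂ} {g : X → ℂ}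
    (hv : ∀ b, (fun x ↦ v x b) =O[l] g) (a : A) : (fun x ↦ transfer G (v x) a) =O[l] g := by
  classical
  refine IsBigO.fun_sum fun b _ ↦ ?_
  split_ifs
  · exact hv b
  · exact isBigO_zero _ _

end Transfer

theorem qpow_T_smul (r : ℚ) (τ : ℍ) :
    qpow r (ModularGroup.T • τ) = e (r : ℚ/ℤ) * qpow r τ := by
  rw [e_coe, qpow, qpow, ← Complex.exp_add, UpperHalfPlane.modular_T_smul, coe_vadd]
  congr 1
  push_cast
  ring

open scoped ComplexOrder in
theorem qpow_I_pos (r : ℚ) : 0 < qpow r UpperHalfPlane.I := by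
  have h : qpow r UpperHalfPlane.I = ((Real.exp (-(2 * Real.pi * r)) : ℝ) : ℂ) := by
    rw [qpow, Complex.ofReal_exp]
    congr 1
    push_cast
    linear_combination (2 * Real.pi * (r : ℂ)) * Complex.I_mul_I
  rw [h]
  exact_mod_cast Real.exp_pos _

namespace EvenLattice

namespace MaximalIsotropic

variable {V : Type*} [AddCommGroup V] [Module ℚ V] {L : EvenLattice V} (I : L.MaximalIsotropic)

/-! ### The theta series of `K(-1)`, pulled back to `A_L` -/

/-- The image in `K^∨` of the vectors of `L^∨ ∩ I^⊥` of class `a ∈ A_L`. It is empty or a coset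
of `K`. -/
def thetaSupport (a : L.A) : Set I.W :=
  {k | ∃ (x : I.perp) (h : (x : V) ∈ L.dual), L.cls ⟨x, h⟩ = a ∧ I.proj x = k}

/-- The component at `a ∈ A_L` of the pullback `Θ_{K(-1)}↑` of the theta series to `ℂA_L`, so that
`ξ(f)` is the pairing of `f` with this pullback. -/
def thetaUp (a : L.A) (τ : ℍ) : ℂ := ∑' k : I.thetaSupport a, qpow (-(I.formW k k) / 2) τ

theorem thetaSupport_subset_K_dual (a : L.A) : I.thetaSupport a ⊆ I.K.dual := by
  rintro _ ⟨x, h, -, rfl⟩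
  exact I.proj_mem_K_dual h

theorem mem_thetaSupport_zero {k : I.W} (hk : k ∈ I.K.carrier) : k ∈ I.thetaSupport 0 := by
  obtain ⟨x, hx, rfl⟩ := hk
  exact ⟨x, L.carrier_le_dual hx, L.cls_eq_zero_iff.mpr hx, rfl⟩

theorem add_mem_thetaSupport {a b : L.A} {k l : I.W} (hk : k ∈ I.thetaSupport a)
    (hl : l ∈ I.thetaSupport b) : k + l ∈ I.thetaSupport (a + b) := by
  obtain ⟨x, hx, rfl, rfl⟩ := hk
  obtain ⟨y, hy, rfl, rfl⟩ := hl
  exact ⟨x + y, add_mem hx hy, rfl, map_add _ _ _⟩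

theorem neg_mem_thetaSupport {a : L.A} {k : I.W} (hk : k ∈ I.thetaSupport a) :
    -k ∈ I.thetaSupport (-a) := by
  obtain ⟨x, hx, rfl, rfl⟩ := hk
  exact ⟨-x, neg_mem hx, rfl, map_neg _ _⟩

theorem mem_thetaSupport_of_sub_mem_K {a : L.A} {k l : I.W} (hk : k ∈ I.thetaSupport a)
    (hl : l - k ∈ I.K.carrier) : l ∈ I.thetaSupport a := by
  simpa only [add_sub_cancel, add_zero] using
    I.add_mem_thetaSupport hk (I.mem_thetaSupport_zero hl)

theorem sub_mem_K_of_mem_thetaSupport {a : L.A} {k l : I.W} (hk : k ∈ I.thetaSupport a)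
    (hl : l ∈ I.thetaSupport a) : k - l ∈ I.K.carrier := by
  obtain ⟨x, hx, hxa, rfl⟩ := hk
  obtain ⟨y, hy, hya, rfl⟩ := hl
  rw [← map_sub]
  exact I.proj_mem_K (L.cls_eq_cls_iff.mp (hxa.trans hya.symm))

theorem coe_formW_eq_pair {a b : L.A} {k l : I.W} (hk : k ∈ I.thetaSupport a)
    (hl : l ∈ I.thetaSupport b) : ((I.formW k l : ℚ) : ℚ/ℤ) = L.pair a b := by
  obtain ⟨x, hx, rfl, rfl⟩ := hk
  obtain ⟨y, hy, rfl, rfl⟩ := hl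
  rfl

theorem mem_thetaSupport_of_forall_form {z : L.dual} {k : I.W}
    (h : ∀ x : I.perp, (x : V) ∈ L.dual → ∃ j : ℤ, L.form x z - I.formW (I.proj x) k = j) :
    k ∈ I.thetaSupport (L.cls z) := by
  obtain ⟨l, hl, hlp⟩ : ∃ l ∈ L.carrier, (z : V) - l ∈ I.perp := by
    refine I.exists_sub_mem_perp fun y hy ↦ ?_
    obtain ⟨j, hj⟩ := h ⟨y, I.rat_le_perp hy.1⟩ hy.2
    rw [(I.proj_eq_zero_iff (x := ⟨y, _⟩)).mpr hy.1, map_zero, LinearMap.zero_apply, sub_zero] at hj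
    exact ⟨j, by rw [L.form_comm, ← hj]⟩
  let u : I.perp := ⟨z - l, hlp⟩
  have hu : I.proj u ∈ I.thetaSupport (L.cls z) := by
    refine ⟨u, sub_mem z.2 (L.carrier_le_dual hl), L.cls_eq_cls_iff.mpr ?_, rfl⟩
    change (z : V) - l - z ∈ L.carrier
    rw [sub_sub_cancel_left]
    exact neg_mem hl
  refine I.mem_thetaSupport_of_sub_mem_K hu (I.K.mem_carrier_of_form_dual fun y hy ↦ ?_)
  obtain ⟨x, hx, rfl⟩ := I.exists_proj_eq_of_mem_K_dual hy
  obtain ⟨j, hj⟩ := h x hx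
  obtain ⟨j', hj'⟩ := L.dual_pair hx hl
  refine ⟨-j + j', ?_⟩
  have hux : I.formW (I.proj x) (I.proj u) = L.form x z - L.form x l :=
    map_sub (L.form x) (z : V) l
  rw [I.K.form_comm]
  change I.formW (I.proj x) (k - I.proj u) = _
  rw [map_sub, hux, hj']
  push_cast
  linarith

/-- The relation between `A_L` and `A_K` underlying `↓^L_K`: some vector of `L^∨ ∩ I^⊥` has class
`a` in `A_L` and class `l` in `A_K`. -/
def DownRel (a : L.A) (l : I.K.A) : Prop :=
  ∃ (k : I.W) (h : k ∈ I.K.dual), k ∈ I.thetaSupport a ∧ I.K.cls ⟨k, h⟩ = l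

theorem DownRel.unique {a : L.A} {l l' : I.K.A} (h : I.DownRel a l) (h' : I.DownRel a l') :
    l = l' := by
  obtain ⟨k, hk, hka, rfl⟩ := h
  obtain ⟨k', hk', hka', rfl⟩ := h'
  exact I.K.cls_eq_cls_iff.mpr (I.sub_mem_K_of_mem_thetaSupport hka hka')

theorem mem_overlattice_dual {x : I.perp} (hx : (x : V) ∈ L.dual) :
    (x : V) ∈ I.overlattice.dual := by
  rw [mem_dual_iff]
  intro y hy
  obtain ⟨l, hl, i, hi, rfl⟩ := Submodule.mem_sup.mp hy
  obtain ⟨n, hn⟩ := L.dual_pair hx hl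
  refine ⟨n, ?_⟩
  change L.form x (l + i) = n
  rw [map_add, I.form_perp_right x.2 hi.1, add_zero, hn]

theorem exists_overlattice_cls_iff_downRel (a : L.A) (l : I.K.A) :
    (∃ m : I.overlattice.A,
      (∃ (x : I.perp) (h : (x : V) ∈ I.overlattice.dual) (h' : I.proj x ∈ I.K.dual),
        I.overlattice.cls ⟨x, h⟩ = m ∧ I.K.cls ⟨I.proj x, h'⟩ = l) ∧
      ∃ (x : V) (h : x ∈ L.dual) (h' : x ∈ I.overlattice.dual),
        L.cls ⟨x, h⟩ = a ∧ I.overlattice.cls ⟨x, h'⟩ = m) ↔ I.DownRel a l := by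
  constructor
  · rintro ⟨m, ⟨x, hx, hx', hxm, rfl⟩, y, hy, hy', rfl, hym⟩
    obtain ⟨t, ht, i, hi, hti⟩ :=
      Submodule.mem_sup.mp (I.overlattice.cls_eq_cls_iff.mp (hym.trans hxm.symm))
    have hxi : (x : V) + i = y - t := by
      have h : t + i = y - x := hti
      rw [eq_sub_iff_add_eq, add_assoc, add_comm i t, h, add_sub_cancel]
    have hxi_mem : (x : V) + i ∈ L.dual := hxi ▸ sub_mem hy (L.carrier_le_dual ht)
    refine ⟨I.proj x, hx', ⟨x + ⟨i, I.rat_le_perp hi.1⟩, hxi_mem, ?_, ?_⟩, rfl⟩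
    · rw [L.cls_eq_cls_iff]
      change (x : V) + i - y ∈ L.carrier
      rw [hxi, sub_sub_cancel_left]
      exact neg_mem ht
    · rw [map_add, add_eq_left, proj_eq_zero_iff]
      exact hi.1
  · rintro ⟨_, h, ⟨x, hx, rfl, rfl⟩, rfl⟩
    have hx' := I.mem_overlattice_dual hx
    exact ⟨I.overlattice.cls ⟨x, hx'⟩, ⟨x, hx', h, rfl, rfl⟩, x, hx, hx', rfl, rfl⟩

open Classical in
theorem down_apply (v : L.A → ℂ) (l : I.K.A) :
    I.down v l = ∑ a, if I.DownRel a l then v a else 0 := by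
  simp only [down, ident, push, ← Finset.sum_filter (s := Finset.univ (α := I.overlattice.A))]
  rw [Finset.sum_comm]
  refine Finset.sum_congr rfl fun a _ ↦ ?_
  simp only [Finset.sum_filter, ← ite_and]
  rw [sum_ite_eq_ite_exists]
  · exact if_congr (I.exists_overlattice_cls_iff_downRel a l) rfl rfl
  rintro m m' ⟨-, x, hx, hx', hxa, rfl⟩ ⟨-, y, hy, hy', hya, rfl⟩
  rw [cls_eq_cls_iff]
  exact Submodule.mem_sup_left (L.cls_eq_cls_iff.mp (hxa.trans hya.symm))

theorem thetaNeg_eq_thetaUp {a : L.A} {l : I.K.A} (h : I.DownRel a l) (τ : ℍ) :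
    I.K.thetaNeg τ l = I.thetaUp a τ := by
  obtain ⟨k, hk, hka, rfl⟩ := h
  let E : {x : I.K.dual // I.K.cls x = I.K.cls ⟨k, hk⟩} ≃ I.thetaSupport a :=
    { toFun x := ⟨x.1, I.mem_thetaSupport_of_sub_mem_K hka (I.K.cls_eq_cls_iff.mp x.2)⟩
      invFun k' := ⟨⟨k', I.thetaSupport_subset_K_dual a k'.2⟩,
        I.K.cls_eq_cls_iff.mpr (I.sub_mem_K_of_mem_thetaSupport k'.2 hka)⟩ }
  exact E.tsum_eq fun k' ↦ qpow (-(I.formW k' k') / 2) τ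

theorem xi_eq_sum_mul_thetaUp (f : ℍ → L.A → ℂ) (τ : ℍ) :
    I.xi f τ = ∑ a, f τ a * I.thetaUp a τ := by
  classical
  simp_rw [xi, I.down_apply, Finset.sum_mul]
  rw [Finset.sum_comm]
  refine Finset.sum_congr rfl fun a _ ↦ ?_
  calc ∑ l, (if I.DownRel a l then f τ a else 0) * I.K.thetaNeg τ l
      = ∑ l, if I.DownRel a l then f τ a * I.thetaUp a τ else 0 := by
        refine Finset.sum_congr rfl fun l _ ↦ ?_
        split_ifs with h
        · rw [I.thetaNeg_eq_thetaUp h]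
        · exact zero_mul _
    _ = if ∃ l, I.DownRel a l then f τ a * I.thetaUp a τ else 0 :=
        sum_ite_eq_ite_exists (fun _ _ ↦ DownRel.unique I) _
    _ = f τ a * I.thetaUp a τ := by
        refine ite_eq_left_iff.mpr fun h ↦ ?_
        have : IsEmpty (I.thetaSupport a) :=
          ⟨fun k ↦ h ⟨_, k, I.thetaSupport_subset_K_dual a k.2, k.2, rfl⟩⟩
        rw [thetaUp, tsum_empty, mul_zero]

theorem thetaUp_T_smul (a : L.A) (τ : ℍ) :
    I.thetaUp a (ModularGroup.T • τ) = e (-L.q a) * I.thetaUp a τ := by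
  rw [thetaUp, thetaUp, ← tsum_mul_left]
  refine tsum_congr fun k ↦ ?_
  obtain ⟨x, hx, rfl, hk⟩ := k.2
  rw [qpow_T_smul, ← hk, L.q_cls, formW_proj, ← AddCircle.coe_neg, neg_div]

/-- An orthogonal basis of `K ⊗ ℚ` consisting of vectors of `K`, of norms `-N i`. -/
structure OrthFrame (n : ℕ) where
  vec : Module.Basis (Fin n) ℚ I.W
  N : Fin n → ℕ
  neZero : ∀ i, NeZero (N i)
  mem : ∀ i, vec i ∈ I.K.carrier
  form_self : ∀ i, I.formW (vec i) (vec i) = -(N i : ℚ)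
  ortho : ∀ i j, i ≠ j → I.formW (vec i) (vec j) = 0

theorem exists_formW_self_eq_neg {k : I.W} (hk : k ∈ I.K.carrier) (hk₀ : k ≠ 0) :
    ∃ N : ℕ, N ≠ 0 ∧ I.formW k k = -(N : ℚ) := by
  obtain ⟨t, ht⟩ := I.K.even k hk
  replace ht : I.formW k k = 2 * t := ht
  have ht₀ : t < 0 := by
    have h := I.formW_neg hk₀
    rw [ht] at h
    exact_mod_cast (by linarith : (t : ℚ) < 0)
  lift -t to ℕ using by omega with s hs
  refine ⟨2 * s, by omega, ?_⟩
  rw [ht, show t = -s by omega]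
  push_cast
  ring

theorem nonempty_orthFrame : Nonempty (I.OrthFrame (Module.finrank ℚ I.W)) := by
  have := I.K.finiteDimensional
  have : Invertible (2 : ℚ) := invertibleOfNonzero two_ne_zero
  obtain ⟨v, hv⟩ := LinearMap.BilinForm.exists_orthogonal_basis (B := I.K.form)
    ⟨fun x y ↦ I.K.symm.eq x y⟩
  choose m hm hmv using fun i ↦ I.K.exists_smul_mem (v i)
  let w := v.isUnitSMul fun i ↦ isUnit_iff_ne_zero.mpr (Int.cast_ne_zero (α := ℚ).mpr (hm i))
  have hw (i) : w i = m i • v i := by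
    rw [Module.Basis.isUnitSMul_apply, Int.cast_smul_eq_zsmul]
  have hwK (i) : w i ∈ I.K.carrier := by rw [hw]; exact hmv i
  choose N hN₀ hN using fun i ↦ I.exists_formW_self_eq_neg (hwK i) (w.ne_zero i)
  refine ⟨w, N, fun i ↦ ⟨hN₀ i⟩, hwK, hN, fun i j hij ↦ ?_⟩
  have h : I.formW (v i) (v j) = 0 := hv hij
  rw [hw, hw, map_zsmul, map_zsmul, LinearMap.smul_apply, h, smul_zero, smul_zero]

namespace OrthFrame

variable {I} {n : ℕ} (F : I.OrthFrame n)

instance (i : Fin n) : NeZero (F.N i) := F.neZero i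

/-- The vector `k` with `(k, v_i) = m_i`. These vectors form the dual of the lattice spanned by the
frame. -/
def pt : (Fin n → ℤ) →+ I.W :=
  .mk' (fun m ↦ -∑ i, ((m i : ℚ) / F.N i) • F.vec i) fun m m' ↦ by
    simp only [Pi.add_apply, Int.cast_add, add_div, add_smul, Finset.sum_add_distrib, neg_add]

theorem pt_apply (m : Fin n → ℤ) : F.pt m = -∑ i, ((m i : ℚ) / F.N i) • F.vec i := rfl

theorem formW_pt_vec (m : Fin n → ℤ) (i : Fin n) : I.formW (F.pt m) (F.vec i) = m i := by
  have hN : (F.N i : ℚ) ≠ 0 := Nat.cast_ne_zero.mpr (NeZero.ne _)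
  rw [pt_apply, map_neg, LinearMap.neg_apply, map_sum, LinearMap.sum_apply,
    Finset.sum_eq_single i (fun j _ hj ↦ by simp [F.ortho j i hj]) (by simp)]
  simp [F.form_self, hN]

theorem formW_pt_pt (m m' : Fin n → ℤ) :
    I.formW (F.pt m) (F.pt m') = -∑ i, (m i : ℚ) * m' i / F.N i := by
  rw [F.pt_apply m', map_neg, map_sum]
  simp only [map_smul, smul_eq_mul, formW_pt_vec]
  exact congrArg _ (Finset.sum_congr rfl fun i _ ↦ by ring)

theorem pt_injective : Function.Injective F.pt := fun m m' h ↦ by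
  funext i
  have hi := F.formW_pt_vec m i
  rw [h, formW_pt_vec] at hi
  exact_mod_cast hi.symm

theorem exists_pt_eq {k : I.W} (hk : k ∈ I.K.dual) : ∃ m, F.pt m = k := by
  choose m hm using fun i ↦ I.K.dual_pair hk (F.mem i)
  refine ⟨m, sub_eq_zero.mp (I.K.nondeg.1 _ fun y ↦ ?_)⟩
  have h : I.formW (F.pt m - k) = 0 := F.vec.ext fun i ↦ by
    rw [map_sub, LinearMap.sub_apply, formW_pt_vec, LinearMap.zero_apply, sub_eq_zero]
    exact (hm i).symm
  exact LinearMap.congr_fun h y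

/-- Reduction of the coordinates `m_i` modulo `N i`: the class of `F.pt m` in the discriminant
group of the lattice spanned by the frame. -/
def red : (Fin n → ℤ) →+ ∀ i, ZMod (F.N i) :=
  .mk' (fun m i ↦ (m i : ZMod (F.N i))) fun m m' ↦ by
    funext i
    exact Int.cast_add _ _

theorem red_surjective : Function.Surjective F.red := fun b ↦ by
  choose m hm using fun i ↦ ZMod.intCast_surjective (b i)
  exact ⟨m, funext hm⟩

theorem pt_mem_K {m : Fin n → ℤ} (h : F.red m = 0) : F.pt m ∈ I.K.carrier := by
  refine neg_mem (sum_mem fun i _ ↦ ?_)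
  obtain ⟨j, hj⟩ := (ZMod.intCast_zmod_eq_zero_iff_dvd _ _).mp (congrFun h i)
  have hN : (F.N i : ℚ) ≠ 0 := Nat.cast_ne_zero.mpr (NeZero.ne _)
  rw [hj, Int.cast_mul, Int.cast_natCast, mul_div_cancel_left₀ _ hN, Int.cast_smul_eq_zsmul]
  exact I.K.carrier.smul_mem j (F.mem i)

/-- The discriminant bilinear form of the lattice spanned by the frame. -/
def pairing : (∀ i, ZMod (F.N i)) →+ (∀ i, ZMod (F.N i)) →+ ℚ/ℤ :=
  piPairing fun i ↦ -zmodPairing (F.N i)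

theorem isNondegSymm_pairing : IsNondegSymm F.pairing :=
  .pi fun i ↦ (isNondegSymm_zmodPairing (F.N i)).neg

theorem pairing_red (m m' : Fin n → ℤ) :
    F.pairing (F.red m) (F.red m') = (I.formW (F.pt m) (F.pt m') : ℚ/ℤ) := by
  have h (i) : (-zmodPairing (F.N i)) (F.red m i) (F.red m' i) =
      ((-(m i * m' i / F.N i) : ℚ) : ℚ/ℤ) := by
    rw [AddCircle.coe_neg, ← zmodPairing_intCast]
    rfl
  rw [pairing, piPairing_apply, formW_pt_pt, ← Finset.sum_neg_distrib]
  simp only [h]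
  exact (map_sum (QuotientAddGroup.mk' (AddSubgroup.zmultiples (1 : ℚ))) _ _).symm

/-- The correspondence between `A_L` and the discriminant group of the lattice spanned by the
frame given by the vectors of `L^∨ ∩ I^⊥`. -/
def corr : AddSubgroup (L.A × ∀ i, ZMod (F.N i)) where
  carrier := {p | ∃ m, F.red m = p.2 ∧ F.pt m ∈ I.thetaSupport p.1}
  zero_mem' := ⟨0, map_zero _, I.mem_thetaSupport_zero (by rw [map_zero]; exact zero_mem _)⟩
  add_mem' := by
    rintro ⟨a, _⟩ ⟨b, _⟩ ⟨m, rfl, hm⟩ ⟨m', rfl, hm'⟩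
    exact ⟨m + m', map_add _ _ _, by rw [map_add]; exact I.add_mem_thetaSupport hm hm'⟩
  neg_mem' := by
    rintro ⟨a, _⟩ ⟨m, rfl, hm⟩
    exact ⟨-m, map_neg _ _, by rw [map_neg]; exact I.neg_mem_thetaSupport hm⟩

theorem mem_corr_iff (a : L.A) (m : Fin n → ℤ) :
    (a, F.red m) ∈ F.corr ↔ F.pt m ∈ I.thetaSupport a := by
  refine ⟨?_, fun h ↦ ⟨m, rfl, h⟩⟩
  rintro ⟨m', h, hm'⟩
  refine I.mem_thetaSupport_of_sub_mem_K hm' ?_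
  rw [← map_sub]
  exact F.pt_mem_K (by rw [map_sub, h, sub_self])

theorem isLagrangian_corr : IsLagrangian (prodPairing L.pairHom (-F.pairing)) F.corr := by
  have hpair (a b m m') : prodPairing L.pairHom (-F.pairing) (a, F.red m) (b, F.red m') =
      L.pair a b - (I.formW (F.pt m) (F.pt m') : ℚ/ℤ) := by
    rw [← pairing_red, sub_eq_add_neg]
    rfl
  rintro ⟨a, b⟩
  constructor
  · rintro ⟨m, rfl, hm⟩ ⟨a', _⟩ ⟨m', rfl, hm'⟩
    rw [hpair, I.coe_formW_eq_pair hm' hm, sub_self]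
  · intro h
    obtain ⟨m, rfl⟩ := F.red_surjective b
    obtain ⟨z, rfl⟩ := L.cls_surjective a
    refine ⟨m, rfl, I.mem_thetaSupport_of_forall_form fun x hx ↦ ?_⟩
    obtain ⟨m', hm'⟩ := F.exists_pt_eq (I.proj_mem_K_dual hx)
    have hxz := h (L.cls ⟨x, hx⟩, F.red m') ⟨m', rfl, x, hx, rfl, hm'.symm⟩
    rw [hpair, pair_cls, hm', ← AddCircle.coe_sub] at hxz
    obtain ⟨j, hj⟩ := (AddCircle.coe_eq_zero_iff 1).mp hxz
    exact ⟨j, by rw [← hj, zsmul_one]⟩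

theorem qpow_pt (m : Fin n → ℤ) (τ : ℍ) :
    qpow (-(I.formW (F.pt m) (F.pt m)) / 2) τ = ∏ i, qpow (m i ^ 2 / (2 * F.N i)) τ := by
  rw [← qpow_sum, formW_pt_pt, neg_neg, Finset.sum_div]
  congr 1
  exact Finset.sum_congr rfl fun i _ ↦ by ring

theorem hasSum_thetaUp (a : L.A) (τ : ℍ) :
    HasSum (fun k : I.thetaSupport a ↦ qpow (-(I.formW k k) / 2) τ)
      (transfer F.corr (fun b ↦ ∏ i, cosetTheta (F.N i) (b i) τ) a) := by
  classical
  have hsum : HasSum ({m | F.pt m ∈ I.thetaSupport a}.indicator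
      fun m ↦ ∏ i, qpow (m i ^ 2 / (2 * F.N i)) τ)
      (transfer F.corr (fun b ↦ ∏ i, cosetTheta (F.N i) (b i) τ) a) := by
    convert hasSum_prod_qpow_sq_div F.N {b | (a, b) ∈ F.corr} τ using 1
    · funext m
      rw [Set.indicator_apply]
      exact if_congr (F.mem_corr_iff a m).symm rfl rfl
    · exact Finset.sum_congr rfl fun b _ ↦ if_congr Iff.rfl rfl rfl
  rw [← hasSum_subtype_iff_indicator] at hsum
  let E : {m | F.pt m ∈ I.thetaSupport a} ≃ I.thetaSupport a :=
    Equiv.ofBijective (fun m ↦ ⟨F.pt m, m.2⟩)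
      ⟨fun m m' h ↦ Subtype.ext (F.pt_injective (congrArg Subtype.val h)), fun k ↦ by
        obtain ⟨m, hm⟩ := F.exists_pt_eq (I.thetaSupport_subset_K_dual a k.2)
        exact ⟨⟨m, by rw [Set.mem_ofPred_eq, hm]; exact k.2⟩, Subtype.ext hm⟩⟩
  rw [← E.hasSum_iff]
  exact hsum.congr_fun fun m ↦ F.qpow_pt m τ

theorem thetaUp_eq_transfer (τ : ℍ) : (fun a ↦ I.thetaUp a τ) =
    transfer F.corr fun b ↦ ∏ i, cosetTheta (F.N i) (b i) τ :=
  funext fun a ↦ (F.hasSum_thetaUp a τ).tsum_eq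

end OrthFrame

theorem summable_thetaUp (a : L.A) (τ : ℍ) :
    Summable fun k : I.thetaSupport a ↦ qpow (-(I.formW k k) / 2) τ := by
  obtain ⟨F⟩ := I.nonempty_orthFrame
  exact (F.hasSum_thetaUp a τ).summable

theorem mdifferentiable_thetaUp (a : L.A) : MDifferentiable 𝓘(ℂ) 𝓘(ℂ) (I.thetaUp a) := by
  obtain ⟨F⟩ := I.nonempty_orthFrame
  rw [show I.thetaUp a = _ from funext fun τ ↦ congrFun (F.thetaUp_eq_transfer τ) a]
  exact mdifferentiable_transfer
    (fun b ↦ mdifferentiable_fun_prod fun i _ ↦ mdifferentiable_cosetTheta (F.N i) (b i)) a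

theorem thetaUp_isBigO_one (a : L.A) : I.thetaUp a =O[atImInfty] fun _ ↦ (1 : ℂ) := by
  obtain ⟨F⟩ := I.nonempty_orthFrame
  rw [show I.thetaUp a = _ from funext fun τ ↦ congrFun (F.thetaUp_eq_transfer τ) a]
  refine isBigO_transfer (fun b ↦ ?_) a
  refine IsBigO.of_bound (∏ i, ∑' m : ℤ, ‖qpow (m ^ 2 / (2 * F.N i)) UpperHalfPlane.I‖) ?_
  filter_upwards [(atImInfty_mem _).mpr ⟨1, fun z hz ↦ hz⟩] with τ hτ
  rw [norm_prod, norm_one, mul_one]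
  exact Finset.prod_le_prod (fun _ _ ↦ norm_nonneg _) fun i _ ↦ norm_cosetTheta_le (F.N i) (b i) hτ

theorem thetaUp_S_smul (a : L.A) (τ : ℍ) :
    I.thetaUp a (ModularGroup.S • τ) = ((-Complex.I * τ) ^ (1 / 2 : ℂ)) ^ Module.finrank ℚ I.W *
      fourier L.pairHom (fun b ↦ I.thetaUp b τ) a := by
  classical
  obtain ⟨F⟩ := I.nonempty_orthFrame
  let θ (τ : ℍ) (b : ∀ i, ZMod (F.N i)) : ℂ := ∏ i, cosetTheta (F.N i) (b i) τ
  let c : ℂ := ((-Complex.I * τ) ^ (1 / 2 : ℂ)) ^ Module.finrank ℚ I.W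
  have hθ (b) : θ (ModularGroup.S • τ) b = c * fourier F.pairing (θ τ) b := by
    simp only [θ, c, cosetTheta_S_smul, Finset.prod_mul_distrib, Finset.prod_const,
      Finset.card_univ, Fintype.card_fin, OrthFrame.pairing]
    rw [← fourier_piPairing]
  calc I.thetaUp a (ModularGroup.S • τ)
      = transfer F.corr (θ (ModularGroup.S • τ)) a :=
        congrFun (F.thetaUp_eq_transfer (ModularGroup.S • τ)) a
    _ = c * transfer F.corr (fourier F.pairing (θ τ)) a := by
        simp only [transfer, hθ, Finset.mul_sum, mul_ite, mul_zero]
    _ = c * fourier L.pairHom (transfer F.corr (θ τ)) a := by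
        rw [F.isLagrangian_corr.fourier_transfer L.isNondegSymm_pairHom F.isNondegSymm_pairing]
    _ = c * fourier L.pairHom (fun b ↦ I.thetaUp b τ) a := by rw [F.thetaUp_eq_transfer]

open scoped ComplexOrder

theorem thetaUp_I_nonneg (a : L.A) : 0 ≤ I.thetaUp a UpperHalfPlane.I :=
  tsum_nonneg fun _ ↦ (qpow_I_pos _).le

theorem thetaUp_zero_I_pos : 0 < I.thetaUp 0 UpperHalfPlane.I :=
  (I.summable_thetaUp 0 UpperHalfPlane.I).tsum_pos (fun _ ↦ (qpow_I_pos _).le)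
    ⟨0, I.mem_thetaSupport_zero (zero_mem _)⟩ (qpow_I_pos _)

end MaximalIsotropic

end EvenLattice

theorem MeromorphicAtCusp.of_isBigO_one {f : ℍ → ℂ} (hf : f =O[atImInfty] fun _ ↦ (1 : ℂ)) :
    MeromorphicAtCusp f :=
  ⟨0, hf.congr_right fun τ ↦ by rw [Nat.cast_zero, neg_zero, qpow_zero]⟩

theorem MeromorphicAtCusp.mul {f g : ℍ → ℂ} (hf : MeromorphicAtCusp f)
    (hg : MeromorphicAtCusp g) : MeromorphicAtCusp fun τ ↦ f τ * g τ := by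
  obtain ⟨m, hm⟩ := hf
  obtain ⟨n, hn⟩ := hg
  refine ⟨m + n, (hm.mul hn).congr_right fun τ ↦ ?_⟩
  rw [← qpow_add, Nat.cast_add, neg_add]

theorem MeromorphicAtCusp.sum {ι : Type*} {s : Finset ι} {f : ι → ℍ → ℂ}
    (hf : ∀ i ∈ s, MeromorphicAtCusp (f i)) : MeromorphicAtCusp fun τ ↦ ∑ i ∈ s, f i τ := by
  classical
  induction s using Finset.induction_on with
  | empty => exact meromorphicAtCusp_zero
  | insert i s hi ih =>
    simp_rw [Finset.sum_insert hi]
    exact (hf i (Finset.mem_insert_self i s)).add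
      (ih fun j hj ↦ hf j (Finset.mem_insert_of_mem hj))

theorem MeromorphicAtCusp.pow {f : ℍ → ℂ} (hf : MeromorphicAtCusp f) (n : ℕ) :
    MeromorphicAtCusp fun τ ↦ f τ ^ n := by
  induction n with
  | zero => simpa only [pow_zero] using .of_isBigO_one (isBigO_refl _ _)
  | succ n ih => simpa only [pow_succ] using ih.mul hf

theorem eq_of_smul_S_of_smul_T {α : Type*} {f : ℍ → α}
    (hS : ∀ τ, f (ModularGroup.S • τ) = f τ) (hT : ∀ τ, f (ModularGroup.T • τ) = f τ)
    (g : SL(2, ℤ)) (τ : ℍ) : f (g • τ) = f τ := by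
  have hg : g ∈ Subgroup.closure {ModularGroup.S, ModularGroup.T} := by
    rw [SpecialLinearGroup.SL2Z_generators]; trivial
  induction hg using Subgroup.closure_induction generalizing τ with
  | mem g hg =>
    rcases hg with rfl | rfl
    · exact hS τ
    · exact hT τ
  | one => rw [one_smul]
  | mul g h _ _ hg hh => rw [mul_smul, hg, hh]
  | inv g _ hg => rw [← hg, smul_inv_smul]

theorem sq_cpow_half (τ : ℍ) : ((τ : ℂ) ^ (2⁻¹ : ℂ)) ^ 2 = τ := by
  simp

theorem cpow_half_ne_zero (τ : ℍ) : (τ : ℂ) ^ (2⁻¹ : ℂ) ≠ 0 := fun h ↦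
  τ.ne_zero (by rw [← sq_cpow_half, h, zero_pow two_ne_zero])

theorem cpow_half_neg_I_mul (τ : ℍ) :
    (-Complex.I * (τ : ℂ)) ^ (1 / 2 : ℂ) = e ((-1 / 8 : ℚ) : ℚ/ℤ) * (τ : ℂ) ^ (2⁻¹ : ℂ) := by
  have hI : -Complex.I ≠ 0 := neg_ne_zero.mpr Complex.I_ne_zero
  have hpos : 0 < (τ : ℂ).arg :=
    (Complex.arg_nonneg_iff.mpr τ.im_pos.le).lt_of_ne fun h ↦
      τ.im_ne_zero (Complex.arg_eq_zero_iff.mp h.symm).2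
  have hlog : Complex.log (-Complex.I * τ) = Complex.log (-Complex.I) + Complex.log τ := by
    refine Complex.log_mul hI τ.ne_zero ?_
    rw [Complex.arg_neg_I]
    constructor <;> linarith [Complex.arg_le_pi (τ : ℂ), Real.pi_pos]
  rw [Complex.cpow_def_of_ne_zero (mul_ne_zero hI τ.ne_zero),
    Complex.cpow_def_of_ne_zero τ.ne_zero, e_coe, ← Complex.exp_add, hlog, Complex.log_neg_I]
  congr 1
  push_cast
  ring

theorem cpow_half_neg_I_mul_pow (τ : ℍ) (n : ℕ) :
    ((-Complex.I * (τ : ℂ)) ^ (1 / 2 : ℂ)) ^ n =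
      e ((-n / 8 : ℚ) : ℚ/ℤ) * ((τ : ℂ) ^ (2⁻¹ : ℂ)) ^ n := by
  rw [cpow_half_neg_I_mul, mul_pow, ← e_nsmul, ← AddCircle.coe_nsmul, nsmul_eq_mul,
    show (n : ℚ) * (-1 / 8) = -n / 8 by ring]

namespace EvenLattice

variable {V : Type*} [AddCommGroup V] [Module ℚ V] {L : EvenLattice V}

theorem weilS_apply_eq_fourier (v : L.A → ℂ) (a : L.A) :
    L.weilS v a = e ((-L.sigma / 8 : ℚ) : ℚ/ℤ) * fourier (-L.pairHom) v a := by
  rw [fourier, ← mul_assoc, ← div_eq_mul_inv]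
  rfl

theorem MShriek.T_smul {f : ℍ → L.A → ℂ} (hf : f ∈ L.MShriek) (τ : ℍ) (a : L.A) :
    f (ModularGroup.T • τ) a = e (L.q a) * f τ a := by
  have h : f (ModularGroup.T • τ) = (1 : ℂ) ^ L.sigma • L.weilT (f τ) :=
    hf.2.1 (Mp2Z.T, L.weilT) (Submonoid.subset_closure (.inl rfl)) τ
  rw [h, one_zpow, one_smul]
  rfl

theorem MShriek.S_smul {f : ℍ → L.A → ℂ} (hf : f ∈ L.MShriek) (τ : ℍ) :
    f (ModularGroup.S • τ) = ((τ : ℂ) ^ (2⁻¹ : ℂ)) ^ L.sigma • L.weilS (f τ) :=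
  hf.2.1 (Mp2Z.S, L.weilS) (Submonoid.subset_closure (.inr rfl)) τ

theorem mem_MShriek_of_T_of_S {f : ℍ → L.A → ℂ}
    (hd : ∀ a, MDifferentiable 𝓘(ℂ) 𝓘(ℂ) fun τ ↦ f τ a)
    (hm : ∀ a, MeromorphicAtCusp fun τ ↦ f τ a)
    (hT : ∀ τ a, f (ModularGroup.T • τ) a = e (L.q a) * f τ a)
    (hS : ∀ τ, f (ModularGroup.S • τ) = ((τ : ℂ) ^ (2⁻¹ : ℂ)) ^ L.sigma • L.weilS (f τ)) :
    f ∈ L.MShriek := by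
  refine ⟨hd, fun x hx ↦ ?_, hm⟩
  induction hx using Submonoid.closure_induction with
  | mem x hx =>
    rcases hx with rfl | rfl
    · intro τ
      change f (ModularGroup.T • τ) = (1 : ℂ) ^ L.sigma • L.weilT (f τ)
      rw [one_zpow, one_smul]
      exact funext (hT τ)
    · exact hS
  | one =>
    intro τ
    simp only [Prod.fst_one, Prod.snd_one, Mp2Z.one_mat, Mp2Z.one_phi, one_smul, one_zpow,
      Module.End.one_apply]
  | mul x y _ _ hx hy =>
    intro τ
    simp only [Prod.fst_mul, Prod.snd_mul, Mp2Z.mul_mat, Mp2Z.mul_phi, mul_smul, hx, hy,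
      map_smul, Module.End.mul_apply, mul_zpow]

theorem smul_mem_MShriek {g : ℍ → ℂ} (hg : g ∈ ThetaProduct.MShriek) {f : ℍ → L.A → ℂ}
    (hf : f ∈ L.MShriek) : (fun τ ↦ g τ • f τ) ∈ L.MShriek := by
  refine mem_MShriek_of_T_of_S (fun a ↦ hg.1.mul (hf.1 a)) (fun a ↦ hg.2.2.mul (hf.2.2 a))
    (fun τ a ↦ ?_) fun τ ↦ ?_
  · rw [hg.2.1, Pi.smul_apply, Pi.smul_apply, MShriek.T_smul hf, smul_eq_mul, smul_eq_mul,
      mul_left_comm]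
  · rw [hg.2.1, MShriek.S_smul hf, map_smul, smul_comm]

namespace MaximalIsotropic

variable (I : L.MaximalIsotropic)

theorem sigma_eq_neg_finrank : L.sigma = -(Module.finrank ℚ I.W : ℤ) := by
  rw [I.finrank_W, neg_neg]

theorem thetaUp_S_smul_eq_fourier (a : L.A) (τ : ℍ) :
    I.thetaUp a (ModularGroup.S • τ) = e ((L.sigma / 8 : ℚ) : ℚ/ℤ) *
      ((τ : ℂ) ^ (2⁻¹ : ℂ)) ^ (-L.sigma) * fourier L.pairHom (fun b ↦ I.thetaUp b τ) a := by
  rw [thetaUp_S_smul, cpow_half_neg_I_mul_pow, I.sigma_eq_neg_finrank, neg_neg, zpow_natCast,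
    Int.cast_neg, Int.cast_natCast]

theorem xi_T_smul {f : ℍ → L.A → ℂ} (hf : f ∈ L.MShriek) (τ : ℍ) :
    I.xi f (ModularGroup.T • τ) = I.xi f τ := by
  rw [xi_eq_sum_mul_thetaUp, xi_eq_sum_mul_thetaUp]
  refine Finset.sum_congr rfl fun a _ ↦ ?_
  rw [MShriek.T_smul hf, thetaUp_T_smul, mul_mul_mul_comm, ← e_add, add_neg_cancel, e_zero,
    one_mul]

theorem xi_S_smul {f : ℍ → L.A → ℂ} (hf : f ∈ L.MShriek) (τ : ℍ) :
    I.xi f (ModularGroup.S • τ) = I.xi f τ := by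
  let s : ℂ := (τ : ℂ) ^ (2⁻¹ : ℂ)
  have hs : s ^ L.sigma * s ^ (-L.sigma) = 1 := by
    rw [← zpow_add₀ (cpow_half_ne_zero τ), add_neg_cancel, zpow_zero]
  have he : e ((-L.sigma / 8 : ℚ) : ℚ/ℤ) * e ((L.sigma / 8 : ℚ) : ℚ/ℤ) = 1 := by
    rw [← e_add, neg_div, AddCircle.coe_neg, neg_add_cancel, e_zero]
  have hterm (a : L.A) : f (ModularGroup.S • τ) a * I.thetaUp a (ModularGroup.S • τ) =
      fourier L.pairHom (fun b ↦ I.thetaUp b τ) a * fourier (-L.pairHom) (f τ) a := by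
    rw [MShriek.S_smul hf, thetaUp_S_smul_eq_fourier, Pi.smul_apply, smul_eq_mul,
      weilS_apply_eq_fourier]
    linear_combination (fourier L.pairHom (fun b ↦ I.thetaUp b τ) a *
      fourier (-L.pairHom) (f τ) a) * (s ^ L.sigma * s ^ (-L.sigma) * he + hs)
  simp only [xi_eq_sum_mul_thetaUp, hterm, sum_fourier_mul_fourier L.isNondegSymm_pairHom,
    mul_comm (f τ _)]

theorem xi_mem_MShriek {f : ℍ → L.A → ℂ} (hf : f ∈ L.MShriek) :
    I.xi f ∈ ThetaProduct.MShriek := by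
  have hxi : I.xi f = fun τ ↦ ∑ a, f τ a * I.thetaUp a τ := funext (I.xi_eq_sum_mul_thetaUp f)
  refine ⟨?_, eq_of_smul_S_of_smul_T (I.xi_S_smul hf) (I.xi_T_smul hf), ?_⟩
  · rw [hxi]
    exact mdifferentiable_fun_sum fun a _ ↦ (hf.1 a).mul (I.mdifferentiable_thetaUp a)
  · rw [hxi]
    exact .sum fun a _ ↦ (hf.2.2 a).mul (.of_isBigO_one (I.thetaUp_isBigO_one a))

theorem xi_smul (g : ℍ → ℂ) (f : ℍ → L.A → ℂ) :
    I.xi (fun τ ↦ g τ • f τ) = fun τ ↦ g τ * I.xi f τ := by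
  funext τ
  simp only [xi_eq_sum_mul_thetaUp, Finset.mul_sum, Pi.smul_apply, smul_eq_mul, mul_assoc]

end MaximalIsotropic

end EvenLattice

/-! ### A nonzero form, from the theta series by quaternion multiplication -/

section Quaternion

variable {A C : Type*} [AddCommGroup A] [AddCommGroup C] {a b c d : ℤ}

/-- The graph of left multiplication by the quaternion `a + bi + cj + dk` on `A⁴`, regarded as a
subgroup of `A × A⁷`. -/
def quatGraph (A : Type*) [AddCommGroup A] (a b c d : ℤ) : AddSubgroup (A × (Fin 7 → A)) where
  carrier := {p | p.2 3 = a • p.1 - b • p.2 0 - c • p.2 1 - d • p.2 2 ∧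
    p.2 4 = b • p.1 + a • p.2 0 - d • p.2 1 + c • p.2 2 ∧
    p.2 5 = c • p.1 + d • p.2 0 + a • p.2 1 - b • p.2 2 ∧
    p.2 6 = d • p.1 - c • p.2 0 + b • p.2 1 + a • p.2 2}
  zero_mem' := by simp
  add_mem' := by
    rintro p r ⟨h1, h2, h3, h4⟩ ⟨h1', h2', h3', h4'⟩
    refine ⟨?_, ?_, ?_, ?_⟩ <;> simp only [Prod.fst_add, Prod.snd_add, Pi.add_apply, *] <;> module
  neg_mem' := by
    rintro p ⟨h1, h2, h3, h4⟩
    refine ⟨?_, ?_, ?_, ?_⟩ <;> simp only [Prod.fst_neg, Prod.snd_neg, Pi.neg_apply, *] <;> module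

-- Left multiplication by a quaternion scales the pairing on `A⁴` by the norm
-- `a² + b² + c² + d²`, which acts on `A` as `-1`.
theorem pairing_eq_zero_of_mem_quatGraph (P : A →+ A →+ C)
    (hA : ∀ u : A, (1 + a ^ 2 + b ^ 2 + c ^ 2 + d ^ 2) • u = 0) {p r : A × (Fin 7 → A)}
    (hp : p ∈ quatGraph A a b c d) (hr : r ∈ quatGraph A a b c d) :
    P r.1 p.1 + ∑ i, P (r.2 i) (p.2 i) = 0 := by
  obtain ⟨hp3, hp4, hp5, hp6⟩ := hp
  obtain ⟨hr3, hr4, hr5, hr6⟩ := hr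
  have hP (u v : A) : (1 + a ^ 2 + b ^ 2 + c ^ 2 + d ^ 2) • P u v = 0 := by
    rw [← map_zsmul, hA, map_zero]
  simp only [Fin.sum_univ_seven, hp3, hp4, hp5, hp6, hr3, hr4, hr5, hr6, map_add, map_sub,
    map_zsmul, AddMonoidHom.add_apply, AddMonoidHom.sub_apply, AddMonoidHom.zsmul_apply]
  linear_combination (norm := module) hP r.1 p.1 + hP (r.2 0) (p.2 0) + hP (r.2 1) (p.2 1) +
    hP (r.2 2) (p.2 2)

-- Pairing with the graph points over the four basis vectors of `A⁴` shows that `p.1, …, p.2 2` is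
-- minus the conjugate quaternion times `p.2 3, …, p.2 6`; multiply by `a + bi + cj + dk`.
theorem mem_quatGraph_of_pairing_eq_zero {P : A →+ A →+ C} (hP : ∀ u, (∀ v, P v u = 0) → u = 0)
    (hA : ∀ u : A, (1 + a ^ 2 + b ^ 2 + c ^ 2 + d ^ 2) • u = 0) {p : A × (Fin 7 → A)}
    (h : ∀ r ∈ quatGraph A a b c d, P r.1 p.1 + ∑ i, P (r.2 i) (p.2 i) = 0) :
    p ∈ quatGraph A a b c d := by
  have h1 : p.1 + a • p.2 3 + b • p.2 4 + c • p.2 5 + d • p.2 6 = 0 := hP _ fun v ↦ by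
    simpa [Fin.sum_univ_seven, add_assoc] using
      h (v, ![0, 0, 0, a • v, b • v, c • v, d • v]) (by simp [quatGraph])
  have hi : p.2 0 - b • p.2 3 + a • p.2 4 + d • p.2 5 - c • p.2 6 = 0 := hP _ fun v ↦ by
    simpa [Fin.sum_univ_seven, add_assoc, sub_eq_add_neg] using
      h (0, ![v, 0, 0, -b • v, a • v, d • v, -c • v]) (by simp [quatGraph])
  have hj : p.2 1 - c • p.2 3 - d • p.2 4 + a • p.2 5 + b • p.2 6 = 0 := hP _ fun v ↦ by
    simpa [Fin.sum_univ_seven, add_assoc, sub_eq_add_neg] using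
      h (0, ![0, v, 0, -c • v, -d • v, a • v, b • v]) (by simp [quatGraph])
  have hk : p.2 2 - d • p.2 3 + c • p.2 4 - b • p.2 5 + a • p.2 6 = 0 := hP _ fun v ↦ by
    simpa [Fin.sum_univ_seven, add_assoc, sub_eq_add_neg] using
      h (0, ![0, 0, v, -d • v, c • v, -b • v, a • v]) (by simp [quatGraph])
  refine ⟨?_, ?_, ?_, ?_⟩
  · linear_combination (norm := module) hA (p.2 3) - a • h1 + b • hi + c • hj + d • hk
  · linear_combination (norm := module) hA (p.2 4) - b • h1 - a • hi + d • hj - c • hk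
  · linear_combination (norm := module) hA (p.2 5) - c • h1 - d • hi - a • hj + b • hk
  · linear_combination (norm := module) hA (p.2 6) - d • h1 + c • hi - b • hj - a • hk

theorem isLagrangian_quatGraph {P : A →+ A →+ ℚ/ℤ} (hP : IsNondegSymm P)
    (hA : ∀ u : A, (1 + a ^ 2 + b ^ 2 + c ^ 2 + d ^ 2) • u = 0) :
    IsLagrangian (prodPairing P (piPairing fun _ ↦ P)) (quatGraph A a b c d) := by
  intro p
  simp only [prodPairing_apply, piPairing_apply]
  refine ⟨fun hp r hr ↦ pairing_eq_zero_of_mem_quatGraph P hA hp hr,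
    mem_quatGraph_of_pairing_eq_zero (fun u hu ↦ hP.eq_zero fun v ↦ ?_) hA⟩
  rw [hP.symm, hu]

theorem quadraticMap_eq_zero_of_mem_quatGraph (Q : QuadraticMap ℤ A C)
    (hQ : ∀ u, (1 + a ^ 2 + b ^ 2 + c ^ 2 + d ^ 2) • Q u = 0) {p : A × (Fin 7 → A)}
    (hp : p ∈ quatGraph A a b c d) : Q p.1 + ∑ i, Q (p.2 i) = 0 := by
  obtain ⟨hp3, hp4, hp5, hp6⟩ := hp
  have hadd (u v : A) : Q (u + v) = Q u + Q v + QuadraticMap.polar Q u v :=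
    QuadraticMap.map_add Q u v
  have hsub (u v : A) : Q (u - v) = Q u + Q v - QuadraticMap.polar Q u v := by
    rw [sub_eq_add_neg, hadd, Q.map_neg, QuadraticMap.polar_neg_right, sub_eq_add_neg]
  simp only [Fin.sum_univ_seven, hp3, hp4, hp5, hp6, hadd, hsub, Q.map_smul,
    QuadraticMap.polar_add_left, QuadraticMap.polar_sub_left, QuadraticMap.polar_smul_left,
    QuadraticMap.polar_smul_right]
  linear_combination (norm := module) hQ p.1 + hQ (p.2 0) + hQ (p.2 1) + hQ (p.2 2)

end Quaternion

namespace EvenLattice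

variable {V : Type*} [AddCommGroup V] [Module ℚ V] (L : EvenLattice V)

theorem polar_q (a b : L.A) : QuadraticMap.polar L.q a b = L.pair a b := by
  obtain ⟨x, rfl⟩ := L.cls_surjective a
  obtain ⟨y, rfl⟩ := L.cls_surjective b
  rw [QuadraticMap.polar, ← cls_add, q_cls, q_cls, q_cls, pair_cls, ← AddCircle.coe_sub,
    ← AddCircle.coe_sub]
  congr 1
  have := L.form_comm x y
  simp only [Submodule.coe_add, map_add, LinearMap.add_apply]
  linarith

theorem q_zsmul (n : ℤ) (a : L.A) : L.q (n • a) = (n * n) • L.q a := by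
  obtain ⟨x, rfl⟩ := L.cls_surjective a
  change L.q (L.cls (n • x)) = _
  rw [q_cls, q_cls, ← AddCircle.coe_zsmul]
  congr 1
  simp only [Submodule.coe_smul, map_zsmul, LinearMap.smul_apply, zsmul_eq_mul]
  push_cast
  ring

/-- The discriminant form `q_L` as a quadratic map. -/
def quadraticMap : QuadraticMap ℤ L.A ℚ/ℤ :=
  .ofPolar L.q L.q_zsmul (fun a a' b ↦ by simp only [polar_q, ← pairHom_apply, map_add]; rfl)
    fun n a b ↦ by simp only [polar_q, ← pairHom_apply, map_zsmul]; rfl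

theorem quadraticMap_apply (a : L.A) : L.quadraticMap a = L.q a := rfl

theorem two_card_zsmul_q (a : L.A) : (2 * Fintype.card L.A : ℤ) • L.q a = 0 := by
  obtain ⟨x, rfl⟩ := L.cls_surjective a
  have h : (Fintype.card L.A • x : V) ∈ L.carrier :=
    L.cls_eq_zero_iff.mp (card_nsmul_eq_zero (x := L.cls x))
  obtain ⟨m, hm⟩ := L.dual_pair x.2 h
  rw [q_cls, ← AddCircle.coe_zsmul, AddCircle.coe_eq_zero_iff]
  refine ⟨m, ?_⟩
  rw [zsmul_one, ← hm, map_nsmul, nsmul_eq_mul, zsmul_eq_mul]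
  push_cast
  ring

theorem exists_four_squares_eq_two_card : ∃ a b c d : ℤ,
    1 + a ^ 2 + b ^ 2 + c ^ 2 + d ^ 2 = 2 * Fintype.card L.A := by
  obtain ⟨a, b, c, d, h⟩ := Nat.sum_four_squares (2 * Fintype.card L.A - 1)
  have hpos : 0 < Fintype.card L.A := Fintype.card_pos
  refine ⟨a, b, c, d, ?_⟩
  zify [show 1 ≤ 2 * Fintype.card L.A by lia] at h
  linarith

theorem two_card_zsmul (a : L.A) : (2 * Fintype.card L.A : ℤ) • a = 0 := by
  rw [mul_smul, natCast_zsmul, card_nsmul_eq_zero, smul_zero]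

end EvenLattice

section SlashInvariantForm

variable {F : Type*} [FunLike F ℍ ℂ]

theorem slashInvariantForm_smul {k : ℤ} [SlashInvariantFormClass F 𝒮ℒ k] (f : F)
    (g : SL(2, ℤ)) (τ : ℍ) :
    f (g • τ) = denom (g : GL (Fin 2) ℝ) τ ^ k * f τ :=
  SlashInvariantForm.slash_action_eqn'' (Γ := 𝒮ℒ) f (MonoidHom.mem_range.mpr ⟨g, rfl⟩) τ

theorem slashInvariantForm_S_smul {k : ℤ} [SlashInvariantFormClass F 𝒮ℒ k] (f : F) (τ : ℍ) :
    f (ModularGroup.S • τ) = (τ : ℂ) ^ k * f τ := by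
  rw [slashInvariantForm_smul f, ModularGroup.denom_S]

theorem slashInvariantForm_T_smul (k : ℤ) [SlashInvariantFormClass F 𝒮ℒ k] (f : F) (τ : ℍ) :
    f (ModularGroup.T • τ) = f τ := by
  rw [slashInvariantForm_smul (k := k) f, ModularGroup.denom_apply]
  simp [ModularGroup.T]

end SlashInvariantForm

theorem discriminant_S_smul (τ : ℍ) : ModularForm.discriminant (ModularGroup.S • τ) =
    (τ : ℂ) ^ 12 * ModularForm.discriminant τ :=
  slashInvariantForm_S_smul CuspForm.discriminant τ

theorem discriminant_T_smul (τ : ℍ) : ModularForm.discriminant (ModularGroup.T • τ) =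
    ModularForm.discriminant τ :=
  slashInvariantForm_T_smul 12 CuspForm.discriminant τ

/-- The weakly holomorphic scalar form `E₄² / Δ` of weight `-4`. -/
def weightFactor (τ : ℍ) : ℂ := ModularForm.E₄ τ ^ 2 / ModularForm.discriminant τ

theorem weightFactor_S_smul (τ : ℍ) :
    weightFactor (ModularGroup.S • τ) = ((τ : ℂ) ^ 4)⁻¹ * weightFactor τ := by
  have hτ := τ.ne_zero
  have hΔ := ModularForm.discriminant_ne_zero τ
  rw [weightFactor, weightFactor, slashInvariantForm_S_smul, discriminant_S_smul]
  field_simp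

theorem weightFactor_T_smul (τ : ℍ) : weightFactor (ModularGroup.T • τ) = weightFactor τ := by
  rw [weightFactor, weightFactor, slashInvariantForm_T_smul 4, discriminant_T_smul]

theorem mdifferentiable_weightFactor : MDifferentiable 𝓘(ℂ) 𝓘(ℂ) weightFactor := by
  have hE := ModularForm.E₄.holo'.pow 2
  have hΔ := CuspForm.discriminant.holo'
  rw [UpperHalfPlane.mdifferentiable_iff] at hE hΔ ⊢
  exact hE.div hΔ fun z _ ↦ ModularForm.discriminant_ne_zero _

theorem meromorphicAtCusp_weightFactor : MeromorphicAtCusp weightFactor := by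
  have hE : MeromorphicAtCusp (ModularForm.E₄ : ℍ → ℂ) :=
    .of_isBigO_one <| (ModularFormClass.bdd_at_infty ModularForm.E₄).trans
      (isBigO_of_le _ fun _ ↦ by simp)
  have hΔ : MeromorphicAtCusp fun τ ↦ (ModularForm.discriminant τ)⁻¹ := by
    refine ⟨1, (ModularForm.exp_isBigO_discriminant.inv_rev
      (.of_forall fun τ h ↦ absurd h (Real.exp_pos _).ne')).trans (isBigO_of_le _ fun τ ↦ ?_)⟩
    rw [norm_qpow, norm_inv, Real.norm_of_nonneg (Real.exp_pos _).le, ← Real.exp_neg]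
    refine (congrArg Real.exp ?_).le
    push_cast
    ring
  simpa only [← div_eq_mul_inv] using! (hE.pow 2).mul hΔ

theorem weightFactor_ne_zero : weightFactor ≠ 0 := fun h ↦ by
  refine EisensteinSeries.E_ne_zero (k := 4) (by norm_num) ⟨2, rfl⟩ (DFunLike.ext _ _ fun τ ↦ ?_)
  have hτ : ModularForm.E₄ τ ^ 2 / ModularForm.discriminant τ = 0 := congrFun h τ
  simpa [ModularForm.discriminant_ne_zero] using! hτ

namespace EvenLattice

namespace MaximalIsotropic

variable {V : Type*} [AddCommGroup V] [Module ℚ V] {L : EvenLattice V} (I : L.MaximalIsotropic)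

/-- Seven copies of `thetaUp`, transferred to `ℂ[A_L]` along `quatGraph`. If
`1 + a² + b² + c² + d² = 2|A_L|`, this is a form of type `ρ_L` and weight `7 rk(K) / 2`. -/
def quatTheta (a b c d : ℤ) (τ : ℍ) : L.A → ℂ :=
  transfer (quatGraph L.A a b c d) fun u ↦ ∏ i, I.thetaUp (u i) τ

variable {a b c d : ℤ}

theorem quatTheta_T_smul (h : 1 + a ^ 2 + b ^ 2 + c ^ 2 + d ^ 2 = 2 * Fintype.card L.A) (τ : ℍ)
    (x : L.A) :
    I.quatTheta a b c d (ModularGroup.T • τ) x = e (L.q x) * I.quatTheta a b c d τ x := by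
  classical
  rw [quatTheta, quatTheta, transfer, transfer, Finset.mul_sum]
  refine Finset.sum_congr rfl fun u _ ↦ ?_
  split_ifs with hu
  · have hq := quadraticMap_eq_zero_of_mem_quatGraph L.quadraticMap
      (fun u ↦ by rw [h, quadraticMap_apply, two_card_zsmul_q]) hu
    simp only [quadraticMap_apply] at hq
    simp only [thetaUp_T_smul]
    rw [Finset.prod_mul_distrib, ← e_sum, Finset.sum_neg_distrib, ← eq_neg_of_add_eq_zero_left hq]
  · rw [mul_zero]

theorem automorphyFactor_pow_seven (τ : ℍ) :
    (e ((L.sigma / 8 : ℚ) : ℚ/ℤ) * ((τ : ℂ) ^ (2⁻¹ : ℂ)) ^ (-L.sigma)) ^ 7 =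
      ((τ : ℂ) ^ 4) ^ Module.finrank ℚ I.W * (((τ : ℂ) ^ (2⁻¹ : ℂ)) ^ L.sigma *
        e ((-L.sigma / 8 : ℚ) : ℚ/ℤ)) := by
  have he : e ((L.sigma / 8 : ℚ) : ℚ/ℤ) ^ 7 = e ((-L.sigma / 8 : ℚ) : ℚ/ℤ) := by
    have h8 : (7 • (L.sigma / 8 : ℚ) : ℚ) = -L.sigma / 8 + L.sigma • 1 := by
      simp only [nsmul_eq_mul, zsmul_one]
      ring
    rw [← e_nsmul, ← AddCircle.coe_nsmul, h8, AddCircle.coe_add, AddCircle.coe_zsmul,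
      AddCircle.coe_period, smul_zero, add_zero]
  have hs := cpow_half_ne_zero τ
  have hτ := sq_cpow_half τ
  set s := (τ : ℂ) ^ (2⁻¹ : ℂ)
  rw [mul_pow, he, ← hτ, I.sigma_eq_neg_finrank, neg_neg, zpow_natCast, zpow_neg, zpow_natCast]
  field_simp
  ring

theorem quatTheta_S_smul (h : 1 + a ^ 2 + b ^ 2 + c ^ 2 + d ^ 2 = 2 * Fintype.card L.A) (τ : ℍ) :
    I.quatTheta a b c d (ModularGroup.S • τ) = ((τ : ℂ) ^ 4) ^ Module.finrank ℚ I.W •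
      ((τ : ℂ) ^ (2⁻¹ : ℂ)) ^ L.sigma • L.weilS (I.quatTheta a b c d τ) := by
  classical
  have hG : IsLagrangian (prodPairing (-L.pairHom) (-piPairing fun _ ↦ L.pairHom))
      (quatGraph L.A a b c d) := by
    rw [neg_piPairing]
    exact isLagrangian_quatGraph L.isNondegSymm_pairHom.neg fun u ↦ by rw [h, L.two_card_zsmul]
  funext x
  rw [Pi.smul_apply, Pi.smul_apply, weilS_apply_eq_fourier, quatTheta, quatTheta,
    IsLagrangian.fourier_transfer L.isNondegSymm_pairHom.neg
      (.pi fun _ ↦ L.isNondegSymm_pairHom) hG, smul_eq_mul, smul_eq_mul, ← mul_assoc, ← mul_assoc,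
      mul_assoc _ _ (e _), ← automorphyFactor_pow_seven, transfer, transfer, Finset.mul_sum]
  refine Finset.sum_congr rfl fun u _ ↦ ?_
  split_ifs
  · rw [fourier_piPairing _ fun _ b ↦ I.thetaUp b τ]
    simp only [thetaUp_S_smul_eq_fourier]
    rw [Finset.prod_mul_distrib, Finset.prod_const, Finset.card_univ, Fintype.card_fin]
  · rw [mul_zero]

theorem mdifferentiable_quatTheta (x : L.A) :
    MDifferentiable 𝓘(ℂ) 𝓘(ℂ) fun τ ↦ I.quatTheta a b c d τ x :=
  mdifferentiable_transfer
    (fun u ↦ mdifferentiable_fun_prod fun i _ ↦ I.mdifferentiable_thetaUp (u i)) x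

theorem quatTheta_isBigO_one (x : L.A) :
    (fun τ ↦ I.quatTheta a b c d τ x) =O[atImInfty] fun _ ↦ (1 : ℂ) :=
  isBigO_transfer (fun u ↦ by
    simpa using IsBigO.finsetProd (s := Finset.univ) fun i _ ↦ I.thetaUp_isBigO_one (u i)) x

section

open scoped ComplexOrder

theorem quatTheta_I_nonneg (a b c d : ℤ) (x : L.A) :
    0 ≤ I.quatTheta a b c d UpperHalfPlane.I x := by
  classical
  refine Finset.sum_nonneg fun u _ ↦ ?_
  split_ifs
  exacts [Finset.prod_nonneg fun i _ ↦ I.thetaUp_I_nonneg (u i), le_rfl]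

theorem quatTheta_zero_I_pos (a b c d : ℤ) : 0 < I.quatTheta a b c d UpperHalfPlane.I 0 := by
  classical
  refine Finset.sum_pos' (fun u _ ↦ ?_) ⟨0, Finset.mem_univ _, ?_⟩
  · split_ifs
    exacts [Finset.prod_nonneg fun i _ ↦ I.thetaUp_I_nonneg (u i), le_rfl]
  · refine (Finset.prod_pos fun i _ ↦ I.thetaUp_zero_I_pos).trans_eq (if_pos ?_).symm
    exact zero_mem (quatGraph L.A a b c d)

end

theorem weightFactor_pow_smul_quatTheta_mem_MShriek
    (h : 1 + a ^ 2 + b ^ 2 + c ^ 2 + d ^ 2 = 2 * Fintype.card L.A) :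
    (fun τ ↦ weightFactor τ ^ Module.finrank ℚ I.W • I.quatTheta a b c d τ) ∈ L.MShriek := by
  refine mem_MShriek_of_T_of_S
    (fun x ↦ (mdifferentiable_weightFactor.pow _).mul (I.mdifferentiable_quatTheta x))
    (fun x ↦ (meromorphicAtCusp_weightFactor.pow _).mul (.of_isBigO_one (I.quatTheta_isBigO_one x)))
    (fun τ x ↦ ?_) fun τ ↦ ?_
  · rw [Pi.smul_apply, Pi.smul_apply, weightFactor_T_smul, I.quatTheta_T_smul h, smul_eq_mul,
      smul_eq_mul, mul_left_comm]
  · rw [weightFactor_S_smul, I.quatTheta_S_smul h, map_smul, smul_smul, ← mul_pow, mul_right_comm,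
      inv_mul_cancel₀ (pow_ne_zero 4 τ.ne_zero), one_mul, smul_comm]

open scoped ComplexOrder in
theorem exists_ne_zero_mem_MShriek (I : L.MaximalIsotropic) : ∃ f ∈ L.MShriek, f ≠ 0 := by
  obtain ⟨a, b, c, d, h⟩ := L.exists_four_squares_eq_two_card
  refine ⟨_, I.weightFactor_pow_smul_quatTheta_mem_MShriek h, fun h0 ↦ ?_⟩
  have hmul : weightFactor ^ Module.finrank ℚ I.W * (fun τ ↦ I.quatTheta a b c d τ 0) = 0 :=
    funext fun τ ↦ congrFun (congrFun h0 τ) 0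
  rcases (UpperHalfPlane.mul_eq_zero_iff (mdifferentiable_weightFactor.pow _)
    (I.mdifferentiable_quatTheta 0)).mp hmul with hw | hθ
  · refine weightFactor_ne_zero (funext fun τ ↦ ?_)
    exact eq_zero_of_pow_eq_zero (congrFun hw τ)
  · exact (I.quatTheta_zero_I_pos a b c d).ne' (congrFun hθ UpperHalfPlane.I)

open scoped ComplexOrder in
theorem exists_isLittleOQInv_of_sigma_eq_zero (hσ : L.sigma = 0) :
    ∃ f ∈ L.MShriek, f ∉ I.thetaPerp ∧ L.IsLittleOQInv f := by
  obtain ⟨a, b, c, d, h⟩ := L.exists_four_squares_eq_two_card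
  have hn : Module.finrank ℚ I.W = 0 := by
    have := I.finrank_W
    lia
  have hmem := I.weightFactor_pow_smul_quatTheta_mem_MShriek h
  simp only [hn, pow_zero, one_smul] at hmem
  refine ⟨_, hmem, fun hperp ↦ ?_, fun x ↦ (I.quatTheta_isBigO_one x).trans_isLittleO <|
    isLittleO_const_left.mpr (.inr tendsto_norm_qpow_neg_one)⟩
  have hpos : 0 < I.xi (I.quatTheta a b c d) UpperHalfPlane.I := by
    rw [xi_eq_sum_mul_thetaUp]
    exact Finset.sum_pos' (fun x _ ↦ mul_nonneg (I.quatTheta_I_nonneg a b c d x)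
      (I.thetaUp_I_nonneg x)) ⟨0, Finset.mem_univ _,
        mul_pos (I.quatTheta_zero_I_pos a b c d) I.thetaUp_zero_I_pos⟩
  exact hpos.ne' (congrFun hperp.2 UpperHalfPlane.I)

end MaximalIsotropic

end EvenLattice

/-! ### Forms which are `o(q⁻¹)` at the cusp -/

theorem discriminant_isBigO_qpow : ModularForm.discriminant =O[atImInfty] qpow 1 := by
  have h : ModularForm.discriminant =O[atImInfty] fun τ ↦ Real.exp (-2 * Real.pi * τ.im / 1) :=
    CuspFormClass.exp_decay_atImInfty CuspForm.discriminant one_pos one_mem_strictPeriods_SL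
  refine h.trans (isBigO_of_le _ fun τ ↦ ?_)
  rw [norm_qpow, Real.norm_of_nonneg (Real.exp_pos _).le]
  refine (congrArg Real.exp ?_).le
  push_cast
  ring

theorem tendsto_mul_discriminant {f : ℍ → ℂ} (hf : f =o[atImInfty] qpow (-1)) :
    Tendsto (fun τ ↦ f τ * ModularForm.discriminant τ) atImInfty (𝓝 0) := by
  rw [← isLittleO_one_iff ℂ]
  refine (hf.mul_isBigO discriminant_isBigO_qpow).congr_right fun τ ↦ ?_
  rw [← qpow_add, neg_add_cancel, qpow_zero]

theorem MShriek.slash_mul_discriminant {f : ℍ → ℂ} (hf : f ∈ MShriek) (γ : SL(2, ℤ)) :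
    SlashAction.map (12 : ℤ) γ (fun τ ↦ f τ * ModularForm.discriminant τ) =
      fun τ ↦ f τ * ModularForm.discriminant τ := by
  funext τ
  have h := congrFun (SlashInvariantForm.slash_action_generators_SL2Z
    ModularForm.discriminant_S_invariant ModularForm.discriminant_T_invariant γ) τ
  rw [ModularForm.SL_slash_apply] at h ⊢
  rw [hf.2.1, mul_assoc, h]

/-- The cusp form `f · Δ` of weight `12`, for a scalar form `f` of weight `0` which is `o(q⁻¹)`. -/
def mulDiscriminant {f : ℍ → ℂ} (hf : f ∈ MShriek) (ho : f =o[atImInfty] qpow (-1)) :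
    CuspForm 𝒮ℒ 12 where
  toFun τ := f τ * ModularForm.discriminant τ
  slash_action_eq' := by
    rintro _ ⟨γ, rfl⟩
    exact MShriek.slash_mul_discriminant hf γ
  holo' := hf.1.mul CuspForm.discriminant.holo'
  zero_at_cusps' {c} hc := by
    rw [Subgroup.IsArithmetic.isCusp_iff_isCusp_SL2Z] at hc
    rw [OnePoint.isZeroAt_iff_forall_SL2Z hc]
    intro γ _
    rw [MShriek.slash_mul_discriminant hf]
    exact tendsto_mul_discriminant ho

theorem one_mem_MShriek : (fun _ ↦ 1 : ℍ → ℂ) ∈ MShriek :=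
  ⟨mdifferentiable_const, fun _ _ ↦ rfl, .of_isBigO_one (isBigO_refl _ _)⟩

theorem MShriek.exists_eq_const {f : ℍ → ℂ} (hf : f ∈ MShriek)
    (ho : f =o[atImInfty] qpow (-1)) : ∃ c : ℂ, f = fun _ ↦ c := by
  obtain ⟨c, hc⟩ := CuspForm.exists_smul_discriminant_of_weight_eq_twelve (mulDiscriminant hf ho)
  refine ⟨c, funext fun τ ↦ mul_right_cancel₀ (ModularForm.discriminant_ne_zero τ) ?_⟩
  exact (DFunLike.congr_fun hc τ).symm

/-! ### Vanishing of forms of large negative weight -/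

-- `‖Φ‖` attains its maximum over `ℍ` on a compact part of the fundamental domain: it is constant.
theorem eq_zero_of_norm_smul_eq {E : Type*} [NormedAddCommGroup E] [NormedSpace ℂ E] {Φ : ℍ → E}
    (hd : DifferentiableOn ℂ (Φ ∘ ofComplex) {z | 0 < z.im})
    (hinv : ∀ (g : SL(2, ℤ)) (τ : ℍ), ‖Φ (g • τ)‖ = ‖Φ τ‖)
    (h0 : Tendsto Φ atImInfty (𝓝 0)) : Φ = 0 := by
  have h0' : Tendsto (fun τ ↦ ‖Φ τ‖) atImInfty (𝓝 0) := tendsto_zero_iff_norm_tendsto_zero.mp h0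
  have hcont : Continuous Φ := by
    have h := hd.continuousOn.comp_continuous continuous_coe fun τ ↦ τ.im_pos
    simpa only [Function.comp_def, ofComplex_apply] using h
  by_contra hne
  obtain ⟨τ₀, hτ₀⟩ := Function.ne_iff.mp hne
  obtain ⟨y, hy⟩ : ∃ y : ℝ, ∀ τ : ℍ, y ≤ τ.im → ‖Φ τ‖ < ‖Φ τ₀‖ :=
    (atImInfty_mem _).mp (h0'.eventually (gt_mem_nhds (norm_pos_iff.mpr hτ₀)))
  have hfd (τ : ℍ) (hτ : ‖Φ τ₀‖ ≤ ‖Φ τ‖) :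
      ∃ σ ∈ ModularGroup.truncatedFundamentalDomain y, ‖Φ σ‖ = ‖Φ τ‖ := by
    obtain ⟨g, hg⟩ := ModularGroup.exists_smul_mem_fd τ
    refine ⟨g • τ, ⟨hg, le_of_not_ge fun h ↦ (hy _ h).not_ge ?_⟩, hinv g τ⟩
    rwa [hinv]
  obtain ⟨σ₀, hσ₀, hσ₀'⟩ := hfd τ₀ le_rfl
  obtain ⟨σ, -, hmax⟩ := (ModularGroup.isCompact_truncatedFundamentalDomain y).exists_isMaxOn
    ⟨σ₀, hσ₀⟩ hcont.norm.continuousOn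
  have hτ₀σ : ‖Φ τ₀‖ ≤ ‖Φ σ‖ := hσ₀' ▸ hmax hσ₀
  have hle (τ : ℍ) : ‖Φ τ‖ ≤ ‖Φ σ‖ := by
    rcases le_total ‖Φ τ‖ ‖Φ τ₀‖ with h | h
    · exact h.trans hτ₀σ
    · obtain ⟨τ', hτ', hnorm⟩ := hfd τ h
      exact hnorm ▸ hmax hτ'
  have hconst (τ : ℍ) : ‖Φ τ‖ = ‖Φ σ‖ := by
    have h := Complex.norm_eqOn_of_isPreconnected_of_isMaxOn
      (convex_halfSpace_im_gt 0).isPreconnected (isOpen_lt continuous_const Complex.continuous_im)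
      hd σ.im_pos (fun z _ ↦ by simpa using hle (ofComplex z)) τ.im_pos
    simpa using h
  have hzero : ‖Φ σ‖ = 0 :=
    tendsto_nhds_unique (tendsto_const_nhds.congr fun τ ↦ (hconst τ).symm) h0'
  exact hτ₀ (norm_le_zero_iff.mp (hτ₀σ.trans_eq hzero))

theorem norm_eta_S_smul (τ : ℍ) : ‖ModularForm.eta (ModularGroup.S • τ : ℍ)‖ =
    ‖(τ : ℂ) ^ (2⁻¹ : ℂ)‖ * ‖ModularForm.eta τ‖ := by
  refine (pow_left_inj₀ (norm_nonneg _) (by positivity) (n := 24) (by norm_num)).mp ?_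
  rw [mul_pow, ← norm_pow, ← norm_pow, ← norm_pow, ← norm_mul, show (24 : ℕ) = 2 * 12 from rfl,
    pow_mul ((τ : ℂ) ^ (2⁻¹ : ℂ)), sq_cpow_half]
  exact congrArg norm (discriminant_S_smul τ)

theorem norm_eta_T_smul (τ : ℍ) :
    ‖ModularForm.eta (ModularGroup.T • τ : ℍ)‖ = ‖ModularForm.eta τ‖ := by
  refine (pow_left_inj₀ (norm_nonneg _) (norm_nonneg _) (n := 24) (by norm_num)).mp ?_
  rw [← norm_pow, ← norm_pow]
  exact congrArg norm (discriminant_T_smul τ)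

theorem eta_isBigO_one : (fun τ : ℍ ↦ ModularForm.eta τ) =O[atImInfty] fun _ ↦ (1 : ℂ) := by
  refine IsBigO.of_pow (n := 24) (by norm_num) ?_
  simp only [Pi.pow_def, one_pow]
  exact ModularForm.discriminant_isZeroAtImInfty.isBigO_one ℂ

theorem tendsto_eta_pow_mul {f : ℍ → ℂ} (hf : f =o[atImInfty] qpow (-1)) {n : ℕ} (hn : 24 ≤ n) :
    Tendsto (fun τ : ℍ ↦ ModularForm.eta τ ^ n * f τ) atImInfty (𝓝 0) := by
  rw [← isLittleO_one_iff ℂ]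
  have h := ((isLittleO_one_iff ℂ).mpr (tendsto_mul_discriminant hf)).mul_isBigO
    (eta_isBigO_one.pow (n - 24))
  simp only [one_pow, mul_one] at h
  refine h.congr_left fun τ ↦ ?_
  rw [ModularForm.discriminant, mul_assoc, ← pow_add, Nat.add_sub_cancel' hn, mul_comm]

namespace EvenLattice

variable {V : Type*} [AddCommGroup V] [Module ℚ V] {L : EvenLattice V}

theorem norm_toLp_weilS (v : L.A → ℂ) : ‖WithLp.toLp 2 (L.weilS v)‖ = ‖WithLp.toLp 2 v‖ := by
  rw [← sq_eq_sq₀ (norm_nonneg _) (norm_nonneg _), EuclideanSpace.norm_sq_eq,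
    EuclideanSpace.norm_sq_eq]
  have hconj (a : L.A) : starRingEnd ℂ (fourier (-L.pairHom) v a) =
      fourier L.pairHom (fun b ↦ starRingEnd ℂ (v b)) a := by
    simp only [fourier, map_mul, map_inv₀, map_sum, Complex.conj_ofReal, conj_e,
      AddMonoidHom.neg_apply, neg_neg]
  have h := sum_fourier_mul_fourier L.isNondegSymm_pairHom (fun b ↦ starRingEnd ℂ (v b)) v
  simp only [← hconj, Complex.conj_mul'] at h
  simp only [weilS_apply_eq_fourier, norm_mul, norm_e, one_mul]
  exact_mod_cast h

theorem MShriek.norm_toLp_T_smul {f : ℍ → L.A → ℂ} (hf : f ∈ L.MShriek) (τ : ℍ) :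
    ‖WithLp.toLp 2 (f (ModularGroup.T • τ))‖ = ‖WithLp.toLp 2 (f τ)‖ := by
  simp only [EuclideanSpace.norm_eq, MShriek.T_smul hf, norm_mul, norm_e, one_mul]

theorem MShriek.norm_toLp_S_smul {f : ℍ → L.A → ℂ} (hf : f ∈ L.MShriek) (τ : ℍ) :
    ‖WithLp.toLp 2 (f (ModularGroup.S • τ))‖ =
      ‖(τ : ℂ) ^ (2⁻¹ : ℂ)‖ ^ L.sigma * ‖WithLp.toLp 2 (f τ)‖ := by
  rw [MShriek.S_smul hf, WithLp.toLp_smul, norm_smul, norm_zpow, norm_toLp_weilS]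

-- The maximum principle applies to `η ^ n • f`, of weight `0` with a unitary multiplier system.
theorem eq_zero_of_isLittleOQInv {f : ℍ → L.A → ℂ} (hf : f ∈ L.MShriek)
    (ho : L.IsLittleOQInv f) (hσ : L.sigma ≤ -24) : f = 0 := by
  obtain ⟨n, hn⟩ : ∃ n : ℕ, L.sigma = -n := ⟨L.sigma.natAbs, by lia⟩
  let Φ (τ : ℍ) : EuclideanSpace ℂ L.A := ModularForm.eta τ ^ n • WithLp.toLp 2 (f τ)
  have hΦ (τ : ℍ) : ‖Φ τ‖ = ‖ModularForm.eta τ‖ ^ n * ‖WithLp.toLp 2 (f τ)‖ := by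
    rw [norm_smul, norm_pow]
  have hS (τ : ℍ) : ‖Φ (ModularGroup.S • τ)‖ = ‖Φ τ‖ := by
    have hτ := norm_ne_zero_iff.mpr (cpow_half_ne_zero τ)
    rw [hΦ, hΦ, norm_eta_S_smul, MShriek.norm_toLp_S_smul hf, hn, zpow_neg, zpow_natCast, mul_pow]
    field_simp
  have hT (τ : ℍ) : ‖Φ (ModularGroup.T • τ)‖ = ‖Φ τ‖ := by
    rw [hΦ, hΦ, norm_eta_T_smul, MShriek.norm_toLp_T_smul hf]
  have hd : DifferentiableOn ℂ (Φ ∘ ofComplex) {z | 0 < z.im} := by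
    refine differentiableOn_euclidean.mpr fun a ↦ ?_
    have hη : DifferentiableOn ℂ (fun z ↦ ModularForm.eta z ^ n) {z | 0 < z.im} := fun z hz ↦
      ((ModularForm.differentiableAt_eta_of_mem_upperHalfPlaneSet hz).pow
        n).differentiableWithinAt
    refine (hη.mul (UpperHalfPlane.mdifferentiable_iff.mp (hf.1 a))).congr fun z hz ↦ ?_
    simp [Φ, ofComplex_apply_of_im_pos hz]
  have hcusp : Tendsto Φ atImInfty (𝓝 0) := by
    have h : Tendsto (fun (τ : ℍ) a ↦ ModularForm.eta τ ^ n * f τ a) atImInfty (𝓝 (0 : L.A → ℂ)) :=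
      tendsto_pi_nhds.mpr fun a ↦ tendsto_eta_pow_mul (ho a) (by lia)
    exact ((PiLp.continuous_toLp 2 fun _ : L.A ↦ ℂ).tendsto 0).comp h
  have hzero : Φ = 0 :=
    eq_zero_of_norm_smul_eq hd (eq_of_smul_S_of_smul_T (f := fun τ ↦ ‖Φ τ‖) hS hT) hcusp
  funext τ
  have hτ : WithLp.toLp 2 (f τ) = 0 := (smul_eq_zero.mp (congrFun hzero τ)).resolve_left
    (pow_ne_zero n (ModularForm.eta_ne_zero τ.im_pos))
  exact (WithLp.toLp_eq_zero 2).mp hτ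

/-! ### Left units -/

namespace MaximalIsotropic

variable (I : L.MaximalIsotropic)

theorem hasLeftUnit_of_xi_eq_one {u : ℍ → L.A → ℂ} (hu : u ∈ L.MShriek)
    (h : I.xi u = fun _ ↦ 1) : I.HasLeftUnit :=
  ⟨u, hu, fun f _ ↦ by funext τ; simp only [thetaProd, h, one_smul]⟩

theorem xi_eq_one_of_forall_thetaProd_eq {u : ℍ → L.A → ℂ} (hu : u ∈ L.MShriek)
    (h : ∀ f ∈ L.MShriek, I.thetaProd u f = f) : I.xi u = fun _ ↦ 1 := by
  obtain ⟨f, hf, hne⟩ := I.exists_ne_zero_mem_MShriek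
  obtain ⟨τ₀, hτ₀⟩ := Function.ne_iff.mp hne
  obtain ⟨a, ha⟩ := Function.ne_iff.mp hτ₀
  have hmul : (fun τ ↦ I.xi u τ - 1) * (fun τ ↦ f τ a) = 0 := by
    funext τ
    have hτ : I.xi u τ * f τ a = f τ a := congrFun (congrFun (h f hf) τ) a
    rw [Pi.mul_apply, Pi.zero_apply, sub_mul, hτ, one_mul, sub_self]
  rcases (UpperHalfPlane.mul_eq_zero_iff
    ((I.xi_mem_MShriek hu).1.sub mdifferentiable_const) (hf.1 a)).mp hmul with h1 | h1
  · exact funext fun τ ↦ sub_eq_zero.mp (congrFun h1 τ)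
  · exact absurd (congrFun h1 τ₀) ha

theorem hasLeftUnit_iff :
    I.HasLeftUnit ↔ ∀ g ∈ ThetaProduct.MShriek, ∃ f ∈ L.MShriek, I.xi f = g := by
  refine ⟨fun ⟨u, hu, h⟩ g hg ↦ ⟨fun τ ↦ g τ • u τ, smul_mem_MShriek hg hu, ?_⟩, fun h ↦ ?_⟩
  · simp only [xi_smul, I.xi_eq_one_of_forall_thetaProd_eq hu h, mul_one]
  · obtain ⟨u, hu, hu1⟩ := h _ one_mem_MShriek
    exact I.hasLeftUnit_of_xi_eq_one hu hu1

theorem xi_isLittleO_qpow {f : ℍ → L.A → ℂ} (ho : L.IsLittleOQInv f) :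
    I.xi f =o[atImInfty] qpow (-1) := by
  rw [show I.xi f = fun τ ↦ ∑ a, f τ a * I.thetaUp a τ from funext (I.xi_eq_sum_mul_thetaUp f)]
  refine IsLittleO.fun_sum fun a _ ↦ ?_
  simpa only [mul_one] using (ho a).mul_isBigO (I.thetaUp_isBigO_one a)

theorem hasLeftUnit_of_isLittleOQInv {f : ℍ → L.A → ℂ} (hf : f ∈ L.MShriek)
    (hp : f ∉ I.thetaPerp) (ho : L.IsLittleOQInv f) : I.HasLeftUnit := by
  obtain ⟨c, hc⟩ := MShriek.exists_eq_const (I.xi_mem_MShriek hf) (I.xi_isLittleO_qpow ho)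
  have hc0 : c ≠ 0 := by
    rintro rfl
    exact hp ⟨hf, hc⟩
  refine I.hasLeftUnit_of_xi_eq_one (L.MShriek.smul_mem c⁻¹ hf) ?_
  rw [show c⁻¹ • f = fun τ ↦ c⁻¹ • f τ from rfl, I.xi_smul (fun _ ↦ c⁻¹) f, hc]
  simp only [inv_mul_cancel₀ hc0]

theorem neg_twentyFour_lt_sigma {f : ℍ → L.A → ℂ} (hf : f ∈ L.MShriek)
    (hp : f ∉ I.thetaPerp) (ho : L.IsLittleOQInv f) : -24 < L.sigma := by
  by_contra! hσ
  refine hp ⟨hf, ?_⟩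
  rw [eq_zero_of_isLittleOQInv hf ho hσ]
  funext τ
  simp only [xi_eq_sum_mul_thetaUp, Pi.zero_apply, zero_mul, Finset.sum_const_zero]

end MaximalIsotropic

end EvenLattice

end ThetaProduct

end

theorem mainTheorem4 {V : Type*} [AddCommGroup V] [Module ℚ V]
    (L : ThetaProduct.EvenLattice V) (hpq : L.sigP ≤ L.sigQ) (I : L.MaximalIsotropic) :
    -- `ξ` maps `M^!(L)` to `M^!`, and `M^!(L)` is closed under the `Θ`-product
    (∀ f ∈ L.MShriek, I.xi f ∈ ThetaProduct.MShriek) ∧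
    (∀ f ∈ L.MShriek, ∀ g ∈ L.MShriek, I.thetaProd f g ∈ L.MShriek) ∧
    -- (1)
    (I.HasLeftUnit ↔ ∀ g ∈ ThetaProduct.MShriek, ∃ f ∈ L.MShriek, I.xi f = g) ∧
    (L.sigma = 0 → I.HasLeftUnit) ∧
    -- (2)
    ((∃ f ∈ L.MShriek, f ∉ I.thetaPerp ∧ L.IsLittleOQInv f) → I.HasLeftUnit) ∧
    ((∃ f ∈ L.MShriek, f ∉ I.thetaPerp ∧ L.IsLittleOQInv f) → |L.sigma| < 24) := by
  have hσ : L.sigma ≤ 0 := sub_nonpos.mpr (Int.ofNat_le.mpr hpq)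
  have hunit : (∃ f ∈ L.MShriek, f ∉ I.thetaPerp ∧ L.IsLittleOQInv f) → I.HasLeftUnit :=
    fun ⟨_, hf, hp, ho⟩ ↦ I.hasLeftUnit_of_isLittleOQInv hf hp ho
  refine ⟨fun _ ↦ I.xi_mem_MShriek,
    fun _ hf _ hg ↦ ThetaProduct.EvenLattice.smul_mem_MShriek (I.xi_mem_MShriek hf) hg,
    I.hasLeftUnit_iff, fun h0 ↦ hunit (I.exists_isLittleOQInv_of_sigma_eq_zero h0), hunit, ?_⟩
  rintro ⟨f, hf, hp, ho⟩
  rw [abs_of_nonpos hσ]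
  exact neg_lt.mp (I.neg_twentyFour_lt_sigma hf hp ho)
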